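/- **Definitions.** Let $W$ be a seven-dimensional complex vector space. A *$(G_2)_{\mathbb C}$-structure* on $W$ is a pair $(\varphi,\mathrm{vol})\in\Lambda^3W^*\times\Lambda^7W^*$ for which there is a basis $E_1,\dots,E_7$ of $W$ with dual basis $E^1,\dots,E^7$ such that $\mathrm{vol}=E^{1234567}$ and $$\varphi=E^{127}+E^{347}+E^{567}+E^{135}-E^{146}-E^{236}-E^{245},$$ where $E^{i_1\cdots i_k}=E^{i_1}\wedge\cdots\wedge E^{i_k}$. It induces a non-degenerate symmetric complex bilinear form $g$ on $W$ by $g(v,w)\,\mathrm{vol}=\tfrac16\,(v\lrcorner\varphi)\wedge(w\lrcorner\varphi)\wedge\varphi$; denote the induced bilinear form on $\Lambda^4W^*$ also by $g$. The Hodge dual $\star\varphi$ is the unique four-form with $\varphi\wedge\chi=g(\star\varphi,\chi)\,\mathrm{vol}$ for all $\chi\in\Lambda^4W^*$. A subspace of $W$ is *non-degenerate* if the restriction of $g$ to it is non-degenerate. A $(G_2)_{\mathbb C}$-structure on a seven-dimensional complex Lie algebra $\mathfrak g$ is *cocalibrated* if $d\star\varphi=0$, where $d$ is the exterior derivative on $\Lambda^*\mathfrak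 g^*$ determined by $(d\alpha)(X,Y)=-\alpha([X,Y])$ for one-forms $\alpha$. For a vector space $V$ with a two-form $\omega$, $\mathfrak{sp}(V,\omega)=\{f\in\mathfrak{gl}(V)\mid \omega(f(x),y)+\omega(x,f(y))=0 \text{ for all } x,y\in V\}$. **Theorem.** Let $\mathfrak g$ be a seven-dimensional complex Lie algebra with a codimension-one Abelian ideal $\mathfrak u$. Let $e_7\in\mathfrak g\setminus\mathfrak u$, let $\omega_6\in\Lambda^2\mathfrak u^*$ be non-degenerate, let $V_4$ be a four-dimensional subspace of $\mathfrak u$, $V_2$ a two-dimensional complement of $V_4$ in $\mathfrak u$, and $\omega_4\in\Lambda^2V_4^*$ non-degenerate. Then: (a) $\mathfrak g$ admits a cocalibrated $(G_2)_{\mathbb C}$-structure such that $\mathfrak u$ is a non-degenerate subspace of $\mathfrak g$ with respect to the induced symmetric complex bilinear form if and only if $\mathrm{ad}(e_7)|_{\mathfrak u}\in\mathfrak{gl}(\mathfrak u)$ is similar under $\mathrm{GL}(\mathfrak u)$ to an element of $\mathfrak{sp}(\mathfrak u,\omega_6)$. (b) $\mathfrak g$ admits a cocalibrated $(G_2)_{\mathbb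 C}$-structure if and only if $\mathrm{ad}(e_7)|_{\mathfrak u}$ is similar under $\mathrm{GL}(\mathfrak u)$ to an element of $\mathfrak{sp}(\mathfrak u,\omega_6)$ or to an element of $$\Bigl\{f\in\mathfrak{gl}(\mathfrak u)\Bigm| f|_{V_2}=f_2+h,\ f_2\in\mathfrak{gl}(V_2),\ h\in\mathrm{Hom}(V_2,V_4),\ f|_{V_4}=-\tfrac{\mathrm{tr}(f_2)}{2}\,\mathrm{id}_{V_4}+f_4,\ f_4\in\mathfrak{sp}(V_4,\omega_4)\Bigr\}.$$ -/

import Mathlib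

open Module

noncomputable section

namespace G2C

section Forms

variable {W : Type*} [AddCommGroup W] [Module ℂ W]

/-- The space of complex `k`-forms on `W`. -/
abbrev Form (W : Type*) [AddCommGroup W] [Module ℂ W] (k : ℕ) : Type _ :=
  W [⋀^Fin k]→ₗ[ℂ] ℂ

/-- The form `α₁ ∧ … ∧ αₘ`, that is `(v₁, …, vₘ) ↦ det (αᵢ (vⱼ))`. -/
def covectorWedge {m : ℕ} (α : Fin m → Dual ℂ W) : Form W m :=
  (Matrix.detRowAlternating (R := ℂ) (n := Fin m)).compLinearMap (LinearMap.pi α)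

/-- For a basis `E` and a multi-index `I = (i₁, …, iₘ)`, the form `E^{i₁} ∧ … ∧ E^{iₘ}` in the dual
basis (indices are counted from `0`). -/
def basisForm {n m : ℕ} (E : Basis (Fin n) ℂ W) (I : Fin m → Fin n) : Form W m :=
  covectorWedge fun k => E.coord (I k)

/-- The wedge product of forms: the signed sum over all `(k, l)`-shuffles. -/
def wedge {k l : ℕ} (a : Form W k) (b : Form W l) : Form W (k + l) :=
  ((LinearMap.mul' ℂ ℂ).compAlternatingMap (a.domCoprod b)).domDomCongr finSumFinEquiv

/-- The interior product `v ⌟ a`, that is `(v₁, …, vₖ) ↦ a (v, v₁, …, vₖ)`. -/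
def interior {k : ℕ} (v : W) (a : Form W (k + 1)) : Form W k :=
  a.curryLeft v

/-- The bilinear form that a non-degenerate bilinear form `B` on `W` induces on `m`-forms,
`(1 / m!) ∑ a(b_{i₁}, …, b_{iₘ}) c(b^{i₁}, …, b^{iₘ})` for a basis `(bᵢ)` of `W` and its `B`-dual
basis `(bⁱ)` of `W`. By `formInner_flat` it is the usual one, determined by
`⟨v₁♭ ∧ … ∧ vₘ♭, w₁♭ ∧ … ∧ wₘ♭⟩ = det (B (vᵢ, wⱼ))`; in particular the basis does not matter. -/
def formInner [FiniteDimensional ℂ W] (B : LinearMap.BilinForm ℂ W) (hB : B.Nondegenerate)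
    {m : ℕ} (a c : Form W m) : ℂ :=
  ((m.factorial : ℂ))⁻¹ * ∑ I : Fin m → Fin (finrank ℂ W),
    a (fun k => finBasis ℂ W (I k)) * c (fun k => B.dualBasis hB (finBasis ℂ W) (I k))

theorem formInner_flat_left [FiniteDimensional ℂ W] (B : LinearMap.BilinForm ℂ W)
    (hB : B.Nondegenerate) {m : ℕ} (v : Fin m → W) (c : Form W m) :
    formInner B hB (covectorWedge fun k => B (v k)) c = c v := by
  set b := finBasis ℂ W
  set d := B.dualBasis hB b
  have hx : ∀ x : W, x = ∑ i, B x (b i) • d i := fun x => by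
    conv_lhs => rw [← d.sum_repr x]
    simp [d, LinearMap.BilinForm.dualBasis_repr_apply]
  have key : ∀ u : Fin m → W,
      c u = ∑ I : Fin m → Fin (finrank ℂ W), (∏ k, B (u k) (b (I k))) * c (fun k => d (I k)) := by
    intro u
    have h1 : c u = c.toMultilinearMap fun k => ∑ i, B (u k) (b i) • d i :=
      congrArg c (funext fun k => hx (u k))
    rw [h1, MultilinearMap.map_sum]
    refine Finset.sum_congr rfl fun I _ => ?_
    rw [MultilinearMap.map_smul_univ]
    rfl
  have hdet : ∀ I : Fin m → Fin (finrank ℂ W),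
      covectorWedge (fun k => B (v k)) (fun k => b (I k)) =
        ∑ σ : Equiv.Perm (Fin m), (Equiv.Perm.sign σ : ℂ) * ∏ k, B (v (σ k)) (b (I k)) := by
    intro I
    have h2 : covectorWedge (fun k => B (v k)) (fun k => b (I k)) =
        (Matrix.of fun j i => B (v i) (b (I j))).det := rfl
    rw [h2, ← Matrix.det_transpose, Matrix.det_apply']
    rfl
  have hperm : ∀ σ : Equiv.Perm (Fin m),
      (Equiv.Perm.sign σ : ℂ) * c (fun k => v (σ k)) = c v := by
    intro σ
    have h3 : c (fun k => v (σ k)) = Equiv.Perm.sign σ • c v := c.map_perm v σ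
    rw [h3, Units.smul_def, zsmul_eq_mul, ← mul_assoc, ← Int.cast_mul, ← Units.val_mul,
      Int.units_mul_self]
    simp
  unfold formInner
  simp_rw [show ∀ I : Fin m → Fin (finrank ℂ W),
      covectorWedge (fun k => B (v k)) (fun k => finBasis ℂ W (I k)) = _ from hdet,
    Finset.sum_mul]
  rw [Finset.sum_comm]
  simp_rw [mul_assoc, ← Finset.mul_sum]
  rw [Finset.sum_congr rfl fun σ _ => by
    rw [show (∑ I : Fin m → Fin (finrank ℂ W), (∏ k, B (v (σ k)) (b (I k))) *
      c (fun k => B.dualBasis hB (finBasis ℂ W) (I k))) = c (fun k => v (σ k)) from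
        (key fun k => v (σ k)).symm, hperm σ]]
  rw [Finset.sum_const, Finset.card_univ, Fintype.card_perm, Fintype.card_fin, nsmul_eq_mul,
    inv_mul_cancel_left₀ (Nat.cast_ne_zero.mpr m.factorial_ne_zero)]

theorem formInner_flat [FiniteDimensional ℂ W] (B : LinearMap.BilinForm ℂ W)
    (hB : B.Nondegenerate) {m : ℕ} (v w : Fin m → W) :
    formInner B hB (covectorWedge fun k => B (v k)) (covectorWedge fun k => B (w k)) =
      (Matrix.of fun i j => B (w j) (v i)).det := by
  rw [formInner_flat_left]
  rfl

/-- `(φ, vol)` is a `(G₂)_ℂ`-structure on the complex vector space `W`: for some basis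
`E₁, …, E₇` of `W`, `vol = E^{1234567}` and
`φ = E^{127} + E^{347} + E^{567} + E^{135} - E^{146} - E^{236} - E^{245}`. -/
def IsG2Structure (φ : Form W 3) (vol : Form W 7) : Prop :=
  ∃ E : Basis (Fin 7) ℂ W,
    vol = basisForm E ![0, 1, 2, 3, 4, 5, 6] ∧
    φ = basisForm E ![0, 1, 6] + basisForm E ![2, 3, 6] + basisForm E ![4, 5, 6]
      + basisForm E ![0, 2, 4] - basisForm E ![0, 3, 5] - basisForm E ![1, 2, 5]
      - basisForm E ![1, 3, 4]

/-- `B` is the symmetric bilinear form induced by `(φ, vol)`: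
`B(v, w) vol = (1/6) (v ⌟ φ) ∧ (w ⌟ φ) ∧ φ`. -/
def IsInducedForm (φ : Form W 3) (vol : Form W 7) (B : LinearMap.BilinForm ℂ W) : Prop :=
  ∀ v w : W, B v w • vol = (1 / 6 : ℂ) • wedge (wedge (interior v φ) (interior w φ)) φ

theorem IsInducedForm.unique {φ : Form W 3} {vol : Form W 7} (hvol : vol ≠ 0)
    {B B' : LinearMap.BilinForm ℂ W} (h : IsInducedForm φ vol B) (h' : IsInducedForm φ vol B') :
    B = B' := by
  ext v w
  exact smul_left_injective ℂ hvol ((h v w).trans (h' v w).symm)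

/-- `Ψ` is the Hodge dual of `φ` for the Hodge star operator of the `(G₂)_ℂ`-structure
`(φ, vol)`: `φ ∧ χ = ⟨Ψ, χ⟩ vol` for all `4`-forms `χ`, where `⟨·,·⟩` is induced by the bilinear
form of `(φ, vol)`. -/
def IsHodgeDual [FiniteDimensional ℂ W] (φ : Form W 3) (vol : Form W 7) (Ψ : Form W 4) : Prop :=
  ∃ (B : LinearMap.BilinForm ℂ W) (hB : B.Nondegenerate), IsInducedForm φ vol B ∧
    ∀ χ : Form W 4, wedge φ χ = formInner B hB Ψ χ • vol

/-- The subspace `U` is non-degenerate for the bilinear form induced by `(φ, vol)`. -/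
def IsNondegenerateSubspace (φ : Form W 3) (vol : Form W 7) (U : Submodule ℂ W) : Prop :=
  ∃ B : LinearMap.BilinForm ℂ W, IsInducedForm φ vol B ∧ (B.restrict U).Nondegenerate

end Forms

section LieAlgebra

variable {𝔤 : Type*} [LieRing 𝔤] [LieAlgebra ℂ 𝔤]

/-- The exterior derivative of a form on a Lie algebra (as a left-invariant form):
`dω(X₀, …, Xₖ) = ∑_{i < j} (-1)^{i + j} ω([Xᵢ, Xⱼ], X₀, …, X̂ᵢ, …, X̂ⱼ, …, Xₖ)`. -/
def lieExtDeriv {k : ℕ} (ω : Form 𝔤 (k + 1)) (X : Fin (k + 2) → 𝔤) : ℂ :=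
  ∑ i : Fin (k + 1), ∑ j : Fin (k + 2), if i.castSucc < j then
    (-1) ^ ((i : ℕ) + (j : ℕ)) *
      ω (Fin.cons ⁅X i.castSucc, X j⁆ (i.removeNth (j.removeNth X)))
  else 0

/-- On one-forms, `dα(X, Y) = -α([X, Y])`. -/
theorem lieExtDeriv_one (α : Form 𝔤 1) (X Y : 𝔤) : lieExtDeriv α ![X, Y] = -α ![⁅X, Y⁆] := by
  have h : (Fin.cons ⁅X, Y⁆ ((0 : Fin 1).removeNth ((1 : Fin 2).removeNth ![X, Y])) : Fin 1 → 𝔤) =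
      ![⁅X, Y⁆] := by
    funext i
    fin_cases i
    rfl
  simp [lieExtDeriv, Fin.sum_univ_two, h, -Fin.removeNth_zero]

/-- `(φ, vol)` is a cocalibrated `(G₂)_ℂ`-structure on the Lie algebra: `d ⋆φ = 0`. -/
def IsCocalibratedG2Structure [FiniteDimensional ℂ 𝔤] (φ : Form 𝔤 3) (vol : Form 𝔤 7) : Prop :=
  IsG2Structure φ vol ∧ ∃ Ψ : Form 𝔤 4, IsHodgeDual φ vol Ψ ∧ lieExtDeriv Ψ = 0

end LieAlgebra

section Endomorphisms

variable {U : Type*} [AddCommGroup U] [Module ℂ U]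

/-- `f` is similar under `GL(U)` to an element of `S`. -/
def IsSimilarToElementOf (f : End ℂ U) (S : Set (End ℂ U)) : Prop :=
  ∃ T : U ≃ₗ[ℂ] U, T.conj f ∈ S

/-- For `U = V₂ ⊕ V₄` and a two-form `ω` on `V₄`, the set of all `f` with `f|_{V₂} = f₂ + h` and
`f|_{V₄} = -(tr f₂ / 2) id + f₄`, where `f₂ ∈ gl(V₂)`, `h ∈ Hom(V₂, V₄)`, `f₄ ∈ sp(V₄, ω)`. -/
def lengthTwoStabilizer (V₂ V₄ : Submodule ℂ U) (ω : LinearMap.BilinForm ℂ V₄) :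
    Set (End ℂ U) :=
  {f | ∃ (f₂ : End ℂ V₂) (h : V₂ →ₗ[ℂ] V₄) (f₄ : End ℂ V₄),
    f₄ ∈ skewAdjointLieSubalgebra ω ∧
    (∀ v : V₂, f v = f₂ v + h v) ∧
    (∀ v : V₄, f v = (-(LinearMap.trace ℂ V₂ f₂ / 2)) • (v : U) + f₄ v)}

end Endomorphisms

end G2C

end

/-! Write `F = ad e₇` and let `α` be the covector with kernel `𝔲` and `α e₇ = 1`. As `𝔲` is Abelian,
`⁅x, y⁆ = α x • F y - α y • F x` (`exists_conormal`). Hence `dΨ = -α ∧ (F·Ψ)` for a four-form `Ψ`,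
and closedness of `⋆φ` means that `F` annihilates the restriction of `⋆φ` to `𝔲`. In a basis `E`
adapted to `(φ, vol)` the induced form is `orthoForm E` and `⋆φ` is `psiForm E`
(`isHodgeDual_phiForm_iff`), so everything depends on the position of the hyperplane `𝔲` relative to
`E`.

To construct structures, place `𝔲` in one of two positions. If `𝔲` is `x₇ = 0`, then `⋆φ|𝔲 = ½ ω ∧
ω` with `ω` symplectic, and every `F` in `sp(ω)` annihilates it. If `𝔲` has a null conormal, then
`⋆φ|𝔲 = a₀ ∧ a₁ ∧ τ`, where `τ` is symplectic on the common kernel of the `aᵢ`. The elements of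
`lengthTwoStabilizer` scale `a₀ ∧ a₁` and `τ` by opposite factors, modulo terms that die against `a₀
∧ a₁`.

The other direction needs no orbit classification. Let `n` be the coordinate vector of `α` and `N =
crossMatrix n`, which is the bivector dual to `⋆φ|𝔲`. Closedness becomes `f N + N fᵀ = tr(f) N`
(`crossMatrix_relation`). So the range of `N`, which lies in `𝔲`, is invariant and carries the
inverse symplectic form, scaled by `F` with factor `tr F` (`exists_conformal_form`). From `N² y =
-(n·n) y + (n·y) n`: if `n·n ≠ 0` the range is all of `𝔲`, and comparing traces forces `tr F = 0`.
If `n·n = 0` the range has dimension four, and comparing traces fixes the scalar part in terms of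
the complementary block. The case `n·n = 0` is also exactly the one where `𝔲` is degenerate, which
separates (a) from (b). -/

noncomputable section

namespace G2C

open scoped Matrix

/-! ### Wedge products and the pairing of forms -/

section Forms

variable {W : Type*} [AddCommGroup W] [Module ℂ W]

/-- Evaluation of forms at a tuple of vectors. -/
def evalₗ {m : ℕ} (v : Fin m → W) : Form W m →ₗ[ℂ] ℂ where
  toFun a := a v
  map_add' _ _ := rfl
  map_smul' _ _ := rfl

theorem form_sum_apply {m : ℕ} {ι : Type*} (s : Finset ι) (a : ι → Form W m) (v : Fin m → W) :
    (∑ i ∈ s, a i) v = ∑ i ∈ s, a i v :=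
  map_sum (evalₗ v) a s

theorem covectorWedge_apply {m : ℕ} (α : Fin m → Dual ℂ W) (v : Fin m → W) :
    covectorWedge α v = (Matrix.of fun i j => α i (v j)).det := by
  rw [← Matrix.det_transpose]
  rfl

/-- This is the shape to which `MultilinearMap.domCoprod_alternization` applies; that rule carries
no factorials, so the shuffle wedge of decomposables can be read off from it. -/
theorem covectorWedge_eq_alternatization {m : ℕ} (α : Fin m → Dual ℂ W) :
    covectorWedge α = MultilinearMap.alternatization
      ((MultilinearMap.mkPiAlgebra ℂ (Fin m) ℂ).compLinearMap α) := by
  ext v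
  rw [covectorWedge_apply, MultilinearMap.alternatization_apply, ← Matrix.det_transpose,
    Matrix.det_apply]
  refine Finset.sum_congr rfl fun σ _ => ?_
  simp

theorem covectorWedge_wedge {k l : ℕ} (α : Fin k → Dual ℂ W) (β : Fin l → Dual ℂ W) :
    wedge (covectorWedge α) (covectorWedge β) = covectorWedge (Fin.append α β) := by
  unfold wedge
  simp only [covectorWedge_eq_alternatization]
  rw [← MultilinearMap.domCoprod_alternization]
  ext v
  simp only [AlternatingMap.domDomCongr_apply, LinearMap.compAlternatingMap_apply,
    MultilinearMap.alternatization_apply, map_sum, map_zsmul_unit]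
  rw [← Equiv.sum_comp finSumFinEquiv.permCongr]
  refine Finset.sum_congr rfl fun σ _ => ?_
  rw [Equiv.Perm.sign_permCongr]
  congr 1
  simp [← finSumFinEquiv.prod_comp, Equiv.permCongr_apply]

theorem wedge_add_left {k l : ℕ} (a a' : Form W k) (b : Form W l) :
    wedge (a + a') b = wedge a b + wedge a' b := by
  simp only [wedge, ← AlternatingMap.domCoprod'_apply, TensorProduct.add_tmul, map_add]
  ext; simp

theorem wedge_smul_left {k l : ℕ} (c : ℂ) (a : Form W k) (b : Form W l) :
    wedge (c • a) b = c • wedge a b := by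
  simp only [wedge, ← AlternatingMap.domCoprod'_apply, ← TensorProduct.smul_tmul', map_smul]
  ext; simp

theorem wedge_add_right {k l : ℕ} (a : Form W k) (b b' : Form W l) :
    wedge a (b + b') = wedge a b + wedge a b' := by
  simp only [wedge, ← AlternatingMap.domCoprod'_apply, TensorProduct.tmul_add, map_add]
  ext; simp

theorem wedge_smul_right {k l : ℕ} (c : ℂ) (a : Form W k) (b : Form W l) :
    wedge a (c • b) = c • wedge a b := by
  simp only [wedge, ← AlternatingMap.domCoprod'_apply, TensorProduct.tmul_smul, map_smul]
  ext; simp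

/-- The wedge product as a bilinear map. -/
def wedgeₗ (k l : ℕ) : Form W k →ₗ[ℂ] Form W l →ₗ[ℂ] Form W (k + l) :=
  LinearMap.mk₂ ℂ wedge wedge_add_left wedge_smul_left wedge_add_right wedge_smul_right

/-- The bilinear form for which the basis `E` is orthonormal. -/
def orthoForm {n : ℕ} (E : Basis (Fin n) ℂ W) : LinearMap.BilinForm ℂ W :=
  (dotProductBilin ℂ ℂ (m := Fin n)).compl₁₂ E.equivFun.toLinearMap E.equivFun.toLinearMap

theorem orthoForm_apply {n : ℕ} (E : Basis (Fin n) ℂ W) (v w : W) :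
    orthoForm E v w = ∑ i, E.coord i v * E.coord i w := by
  simp [orthoForm, dotProduct, dotProductBilin]

theorem orthoForm_basis_left {n : ℕ} (E : Basis (Fin n) ℂ W) (i : Fin n) :
    orthoForm E (E i) = E.coord i := by
  ext w
  simp [orthoForm_apply, Finsupp.single_apply]

theorem orthoForm_comm {n : ℕ} (E : Basis (Fin n) ℂ W) (v w : W) :
    orthoForm E v w = orthoForm E w v := by
  simp only [orthoForm_apply, mul_comm]

theorem orthoForm_nondegenerate {n : ℕ} (E : Basis (Fin n) ℂ W) :
    (orthoForm E).Nondegenerate := by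
  have h : ∀ v, (∀ w, orthoForm E v w = 0) → v = 0 := by
    intro v hv
    refine E.ext_elem fun i => ?_
    have := hv (E i)
    rw [orthoForm_comm, orthoForm_basis_left] at this
    simpa using this
  exact ⟨h, fun v hv => h v fun w => by rw [orthoForm_comm]; exact hv w⟩

/-- Expand `formInner_flat_left` at `v`; symmetry of `B` lets each determinant be read as a
decomposable form evaluated at `v`. The factorial compensates for summing over all multi-indices. -/
theorem form_eq_sum_covectorWedge [FiniteDimensional ℂ W] {B : LinearMap.BilinForm ℂ W}
    (hB : B.Nondegenerate) (hs : ∀ v w, B v w = B w v) {m : ℕ} (c : Form W m) :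
    c = ((m.factorial : ℂ))⁻¹ • ∑ I : Fin m → Fin (finrank ℂ W),
      c (fun k => B.dualBasis hB (finBasis ℂ W) (I k)) •
        covectorWedge (fun k => B (finBasis ℂ W (I k))) := by
  ext v
  rw [← formInner_flat_left B hB v c, formInner]
  simp only [AlternatingMap.smul_apply, form_sum_apply, smul_eq_mul]
  congr 1
  refine Finset.sum_congr rfl fun I _ => ?_
  rw [mul_comm, covectorWedge_apply, covectorWedge_apply, ← Matrix.det_transpose]
  congr 2
  ext i j
  exact hs _ _

theorem span_covectorWedge_flat [FiniteDimensional ℂ W] {B : LinearMap.BilinForm ℂ W}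
    (hB : B.Nondegenerate) (hs : ∀ v w, B v w = B w v) (m : ℕ) :
    Submodule.span ℂ (Set.range fun v : Fin m → W => covectorWedge fun k => B (v k)) = ⊤ := by
  refine eq_top_iff.2 fun c _ => ?_
  rw [form_eq_sum_covectorWedge hB hs c]
  exact Submodule.smul_mem _ _ (Submodule.sum_mem _ fun I _ =>
    Submodule.smul_mem _ _ (Submodule.subset_span ⟨_, rfl⟩))

/-- Decomposable forms span, so identities linear in a form need checking only on them. -/
theorem form_induction [FiniteDimensional ℂ W] {m : ℕ} {p : Form W m → Prop}
    (hw : ∀ α : Fin m → Dual ℂ W, p (covectorWedge α)) (h0 : p 0)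
    (hadd : ∀ a b, p a → p b → p (a + b)) (hsmul : ∀ (c : ℂ) a, p a → p (c • a))
    (a : Form W m) : p a := by
  have hE := orthoForm_nondegenerate (finBasis ℂ W)
  have ha : a ∈ Submodule.span ℂ (Set.range fun v : Fin m → W =>
      covectorWedge fun k => orthoForm (finBasis ℂ W) (v k)) := by
    rw [span_covectorWedge_flat hE (orthoForm_comm _)]
    trivial
  induction ha using Submodule.span_induction with
  | mem x hx => obtain ⟨v, rfl⟩ := hx; exact hw _
  | zero => exact h0
  | add x y _ _ hx hy => exact hadd x y hx hy
  | smul c x _ hx => exact hsmul c x hx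

theorem wedge_two_two_apply [FiniteDimensional ℂ W] (a b : Form W 2) (x y z w : W) :
    wedge a b ![x, y, z, w] = a ![x, y] * b ![z, w] - a ![x, z] * b ![y, w]
      + a ![x, w] * b ![y, z] + a ![y, z] * b ![x, w] - a ![y, w] * b ![x, z]
      + a ![z, w] * b ![x, y] := by
  induction a using form_induction with
  | h0 =>
    change wedgeₗ 2 2 0 b _ = _
    simp
  | hadd a a' ha ha' =>
    rw [wedge_add_left, AlternatingMap.add_apply, ha, ha']
    simp only [AlternatingMap.add_apply]
    ring
  | hsmul c a ha =>
    rw [wedge_smul_left, AlternatingMap.smul_apply, ha]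
    simp only [AlternatingMap.smul_apply, smul_eq_mul]
    ring
  | hw α =>
    induction b using form_induction with
    | h0 =>
      change wedgeₗ 2 2 _ 0 _ = _
      simp
    | hadd a a' ha ha' =>
      rw [wedge_add_right, AlternatingMap.add_apply, ha, ha']
      simp only [AlternatingMap.add_apply]
      ring
    | hsmul c a ha =>
      rw [wedge_smul_right, AlternatingMap.smul_apply, ha]
      simp only [AlternatingMap.smul_apply, smul_eq_mul]
      ring
    | hw β =>
      rw [covectorWedge_wedge]
      have h : (Fin.append α β : Fin 4 → Dual ℂ W) = ![α 0, α 1, β 0, β 1] := by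
        ext i; fin_cases i <;> rfl
      have h4 : ∀ γ : Fin 4 → Dual ℂ W, covectorWedge γ ![x, y, z, w] =
          (Matrix.of fun i j => γ i (![x, y, z, w] j)).det := fun γ => covectorWedge_apply γ _
      refine (h4 _).trans ?_
      rw [h]
      simp only [covectorWedge_apply, Matrix.det_fin_two, Matrix.det_succ_row_zero (n := 3),
        Matrix.det_fin_three, Fin.sum_univ_four, Matrix.of_apply, Matrix.submatrix_apply,
        Matrix.cons_val, Fin.succAbove, Fin.succ, Fin.lt_def, Fin.castSucc]
      simp
      ring

/-- For decomposable `χ` the value is the determinant of a block triangular matrix whose first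
diagonal block is the identity, since the indices in `L` and `M` are all distinct. -/
theorem basisForm_wedge_apply_basis [FiniteDimensional ℂ W] {k l n : ℕ}
    (E : Basis (Fin n) ℂ W) {L : Fin k → Fin n} {M : Fin l → Fin n}
    {v : Fin (k + l) → W}
    (hv : ∀ i, v i = E (Fin.append L M i)) (hinj : Function.Injective (Fin.append L M)) (χ : Form W l) :
    evalₗ v (wedge (basisForm E L) χ) = χ (E ∘ M) := by
  obtain rfl := funext hv
  induction χ using form_induction with
  | h0 =>
    change evalₗ _ (wedgeₗ k l _ 0) = _
    simp
  | hadd a b ha hb => rw [wedge_add_right, map_add, ha, hb, AlternatingMap.add_apply]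
  | hsmul c a ha => rw [wedge_smul_right, map_smul, ha, AlternatingMap.smul_apply]
  | hw β =>
    rw [basisForm, covectorWedge_wedge]
    change covectorWedge _ _ = _
    rw [covectorWedge_apply, ← Matrix.det_submatrix_equiv_self finSumFinEquiv]
    have : (Matrix.of fun i j => Fin.append (fun i => E.coord (L i)) β i
        (E (Fin.append L M j))).submatrix finSumFinEquiv finSumFinEquiv =
        Matrix.fromBlocks 1 0 (Matrix.of fun i j => β i (E (L j)))
          (Matrix.of fun i j => β i (E (M j))) := by
      ext (i | i) (j | j)
      · have := @hinj (Fin.castAdd l i) (Fin.castAdd l j)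
        simp [Finsupp.single_apply, Matrix.one_apply] at this ⊢
        grind
      · have := @hinj (Fin.castAdd l i) (Fin.natAdd k j)
        simp [Finsupp.single_apply, Fin.ext_iff] at this ⊢
        have := i.2
        grind
      · simp
      · simp
    rw [this, Matrix.det_fromBlocks_zero₁₂, Matrix.det_one, one_mul, covectorWedge_apply]
    rfl

theorem wedge_basisForm_apply_basis [FiniteDimensional ℂ W] {k l n : ℕ}
    (E : Basis (Fin n) ℂ W) {L : Fin l → Fin n} {M : Fin k → Fin n}
    {v : Fin (k + l) → W}
    (hv : ∀ i, v i = E (Fin.append M L i)) (hinj : Function.Injective (Fin.append M L)) (χ : Form W k) :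
    evalₗ v (wedge χ (basisForm E L)) = χ (E ∘ M) := by
  obtain rfl := funext hv
  induction χ using form_induction with
  | h0 =>
    change evalₗ _ (wedgeₗ k l 0 _) = _
    simp
  | hadd a b ha hb => rw [wedge_add_left, map_add, ha, hb, AlternatingMap.add_apply]
  | hsmul c a ha => rw [wedge_smul_left, map_smul, ha, AlternatingMap.smul_apply]
  | hw β =>
    rw [basisForm, covectorWedge_wedge]
    change covectorWedge _ _ = _
    rw [covectorWedge_apply, ← Matrix.det_submatrix_equiv_self finSumFinEquiv]
    have : (Matrix.of fun i j => Fin.append β (fun i => E.coord (L i)) i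
        (E (Fin.append M L j))).submatrix finSumFinEquiv finSumFinEquiv =
        Matrix.fromBlocks (Matrix.of fun i j => β i (E (M j)))
          (Matrix.of fun i j => β i (E (L j))) 0 1 := by
      ext (i | i) (j | j)
      · simp
      · simp
      · have := @hinj (Fin.natAdd k i) (Fin.castAdd l j)
        simp [Finsupp.single_apply, Fin.ext_iff] at this ⊢
        have := j.2
        grind
      · have := @hinj (Fin.natAdd k i) (Fin.natAdd k j)
        simp [Finsupp.single_apply, Matrix.one_apply] at this ⊢
        grind
    rw [this, Matrix.det_fromBlocks_zero₂₁, Matrix.det_one, mul_one, covectorWedge_apply]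
    rfl

theorem evalₗ_eq_sign_mul {m : ℕ} (v : Fin m → W) (σ : Equiv.Perm (Fin m)) (a : Form W m) :
    evalₗ v a = (Equiv.Perm.sign σ : ℤ) * evalₗ (v ∘ σ) a := by
  change a v = _ * a (v ∘ σ)
  rw [a.map_perm v σ, Units.smul_def, zsmul_eq_mul, ← mul_assoc, ← Int.cast_mul,
    ← Units.val_mul, Int.units_mul_self]
  simp

theorem wedge_sub_left {k l : ℕ} (a a' : Form W k) (b : Form W l) :
    wedge (a - a') b = wedge a b - wedge a' b := LinearMap.map_sub₂ (wedgeₗ k l) a a' b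

theorem wedge_sub_right {k l : ℕ} (a : Form W k) (b b' : Form W l) :
    wedge a (b - b') = wedge a b - wedge a b' := map_sub (wedgeₗ k l a) b b'

/-! ### The standard three-form, its bilinear form and its Hodge dual -/

/-- The standard three-form of a basis. -/
def phiForm (E : Basis (Fin 7) ℂ W) : Form W 3 :=
  basisForm E ![0, 1, 6] + basisForm E ![2, 3, 6] + basisForm E ![4, 5, 6]
    + basisForm E ![0, 2, 4] - basisForm E ![0, 3, 5] - basisForm E ![1, 2, 5]
    - basisForm E ![1, 3, 4]

/-- The standard volume form of a basis. -/
def volForm (E : Basis (Fin 7) ℂ W) : Form W 7 := basisForm E ![0, 1, 2, 3, 4, 5, 6]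

/-- The Hodge dual of the standard three-form of a basis. -/
def psiForm (E : Basis (Fin 7) ℂ W) : Form W 4 :=
  basisForm E ![2, 3, 4, 5] + basisForm E ![0, 1, 4, 5] + basisForm E ![0, 1, 2, 3]
    - basisForm E ![1, 3, 5, 6] + basisForm E ![1, 2, 4, 6] + basisForm E ![0, 3, 4, 6]
    + basisForm E ![0, 2, 5, 6]

/-- The value of a top form on a basis. -/
def topEval (E : Basis (Fin 7) ℂ W) : Form W 7 →ₗ[ℂ] ℂ := evalₗ E

theorem form_ext_basis (E : Basis (Fin 7) ℂ W) {a b : Form W 7} (h : topEval E a = topEval E b) :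
    a = b := by
  change a E = b E at h
  rw [a.eq_smul_basis_det E, b.eq_smul_basis_det E, h]

theorem volForm_apply_basis (E : Basis (Fin 7) ℂ W) : topEval E (volForm E) = 1 := by
  change volForm E E = 1
  rw [volForm, basisForm, covectorWedge_apply]
  convert Matrix.det_one (n := Fin 7) (R := ℂ)
  ext i j
  have : (![0, 1, 2, 3, 4, 5, 6] : Fin 7 → Fin 7) i = i := by fin_cases i <;> rfl
  rw [Matrix.of_apply, this, Matrix.one_apply, Basis.coord_apply, Basis.repr_self,
    Finsupp.single_apply]
  simp only [eq_comm]

theorem basisForm_three_apply {n : ℕ} (E : Basis (Fin n) ℂ W) (i j k : Fin n) (x y z : W) :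
    basisForm E ![i, j, k] ![x, y, z] =
      E.coord i x * (E.coord j y * E.coord k z - E.coord j z * E.coord k y)
      - E.coord i y * (E.coord j x * E.coord k z - E.coord j z * E.coord k x)
      + E.coord i z * (E.coord j x * E.coord k y - E.coord j y * E.coord k x) := by
  rw [basisForm, covectorWedge_apply, Matrix.det_fin_three]
  simp
  ring

theorem basisForm_four_apply {n : ℕ} (E : Basis (Fin n) ℂ W) (i j k l : Fin n) (x y z w : W) :
    basisForm E ![i, j, k, l] ![x, y, z, w] =
      (E.coord i x * E.coord j y - E.coord i y * E.coord j x)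
          * (E.coord k z * E.coord l w - E.coord k w * E.coord l z)
      - (E.coord i x * E.coord j z - E.coord i z * E.coord j x)
          * (E.coord k y * E.coord l w - E.coord k w * E.coord l y)
      + (E.coord i x * E.coord j w - E.coord i w * E.coord j x)
          * (E.coord k y * E.coord l z - E.coord k z * E.coord l y)
      + (E.coord i y * E.coord j z - E.coord i z * E.coord j y)
          * (E.coord k x * E.coord l w - E.coord k w * E.coord l x)
      - (E.coord i y * E.coord j w - E.coord i w * E.coord j y)
          * (E.coord k x * E.coord l z - E.coord k z * E.coord l x)
      + (E.coord i z * E.coord j w - E.coord i w * E.coord j z)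
          * (E.coord k x * E.coord l y - E.coord k y * E.coord l x) := by
  rw [basisForm, covectorWedge_apply, Matrix.det_succ_row_zero]
  simp only [Matrix.det_fin_three, Fin.sum_univ_four, Matrix.of_apply, Matrix.submatrix_apply,
    Matrix.cons_val, Fin.succAbove, Fin.succ, Fin.lt_def, Fin.castSucc]
  simp
  ring

/-- Each monomial `E^L` of `φ` sees `χ` only on the complementary indices `M`, with the sign of the
permutation `(L, M)`. -/
theorem phiForm_wedge_apply [FiniteDimensional ℂ W] (E : Basis (Fin 7) ℂ W) (χ : Form W 4) :
    topEval E (wedge (phiForm E) χ) = χ ![E 2, E 3, E 4, E 5] + χ ![E 0, E 1, E 4, E 5]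
      + χ ![E 0, E 1, E 2, E 3] - χ ![E 1, E 3, E 5, E 6] + χ ![E 1, E 2, E 4, E 6]
      + χ ![E 0, E 3, E 4, E 6] + χ ![E 0, E 2, E 5, E 6] := by
  -- `g` is the explicit inverse of the list `(L, M)`; with it the permutation is concrete and its
  -- sign is decidable.
  have key : ∀ (L : Fin 3 → Fin 7) (M : Fin 4 → Fin 7) (g : Fin 7 → Fin 7)
      (h₁ : Function.LeftInverse g (Fin.append L M))
      (h₂ : Function.RightInverse g (Fin.append L M)) (s : ℤˣ),
      Equiv.Perm.sign (⟨Fin.append L M, g, h₁, h₂⟩ : Equiv.Perm (Fin 7)) = s →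
      topEval E (wedge (basisForm E L) χ) = (s : ℤ) * χ (E ∘ M) := by
    rintro L M g h₁ h₂ _ rfl
    have h : ∀ v : Fin 7 → W, (∀ i, v i = E (Fin.append L M i)) →
        evalₗ v (wedge (basisForm E L) χ) = χ (E ∘ M) := fun v hv =>
      basisForm_wedge_apply_basis E hv h₁.injective χ
    rw [topEval, evalₗ_eq_sign_mul _ ⟨Fin.append L M, g, h₁, h₂⟩]
    exact congrArg _ (h _ fun _ => rfl)
  have hM : ∀ a b c d, E ∘ ![a, b, c, d] = ![E a, E b, E c, E d] := by
    intro a b c d; ext i; fin_cases i <;> rfl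
  rw [phiForm]
  simp only [wedge_add_left, wedge_sub_left, map_add, map_sub]
  rw [key ![0, 1, 6] ![2, 3, 4, 5] ![0, 1, 3, 4, 5, 6, 2] (by decide) (by decide) 1 (by decide +kernel),
    key ![2, 3, 6] ![0, 1, 4, 5] ![3, 4, 0, 1, 5, 6, 2] (by decide) (by decide) 1 (by decide +kernel),
    key ![4, 5, 6] ![0, 1, 2, 3] ![3, 4, 5, 6, 0, 1, 2] (by decide) (by decide) 1 (by decide +kernel),
    key ![0, 2, 4] ![1, 3, 5, 6] ![0, 3, 1, 4, 2, 5, 6] (by decide) (by decide) (-1) (by decide +kernel),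
    key ![0, 3, 5] ![1, 2, 4, 6] ![0, 3, 4, 1, 5, 2, 6] (by decide) (by decide) (-1) (by decide +kernel),
    key ![1, 2, 5] ![0, 3, 4, 6] ![3, 0, 1, 4, 5, 2, 6] (by decide) (by decide) (-1) (by decide +kernel),
    key ![1, 3, 4] ![0, 2, 5, 6] ![3, 0, 4, 1, 2, 5, 6] (by decide) (by decide) (-1) (by decide +kernel)]
  simp only [hM]
  push_cast
  ring

/-- The values agree with `phiForm_wedge_apply` because degrees three and four commute. -/
theorem wedge_phiForm_apply [FiniteDimensional ℂ W] (E : Basis (Fin 7) ℂ W) (χ : Form W 4) :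
    topEval E (wedge χ (phiForm E)) = χ ![E 2, E 3, E 4, E 5] + χ ![E 0, E 1, E 4, E 5]
      + χ ![E 0, E 1, E 2, E 3] - χ ![E 1, E 3, E 5, E 6] + χ ![E 1, E 2, E 4, E 6]
      + χ ![E 0, E 3, E 4, E 6] + χ ![E 0, E 2, E 5, E 6] := by
  have key : ∀ (L : Fin 3 → Fin 7) (M : Fin 4 → Fin 7) (g : Fin 7 → Fin 7)
      (h₁ : Function.LeftInverse g (Fin.append M L))
      (h₂ : Function.RightInverse g (Fin.append M L)) (s : ℤˣ),
      Equiv.Perm.sign (⟨Fin.append M L, g, h₁, h₂⟩ : Equiv.Perm (Fin 7)) = s →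
      topEval E (wedge χ (basisForm E L)) = (s : ℤ) * χ (E ∘ M) := by
    rintro L M g h₁ h₂ _ rfl
    have h : ∀ v : Fin 7 → W, (∀ i, v i = E (Fin.append M L i)) →
        evalₗ v (wedge χ (basisForm E L)) = χ (E ∘ M) := fun v hv =>
      wedge_basisForm_apply_basis E hv h₁.injective χ
    rw [topEval, evalₗ_eq_sign_mul _ ⟨Fin.append M L, g, h₁, h₂⟩]
    exact congrArg _ (h _ fun _ => rfl)
  have hM : ∀ a b c d, E ∘ ![a, b, c, d] = ![E a, E b, E c, E d] := by
    intro a b c d; ext i; fin_cases i <;> rfl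
  rw [phiForm]
  simp only [wedge_add_right, wedge_sub_right, map_add, map_sub]
  rw [key ![0, 1, 6] ![2, 3, 4, 5] ![4, 5, 0, 1, 2, 3, 6] (by decide) (by decide) 1 (by decide +kernel),
    key ![2, 3, 6] ![0, 1, 4, 5] ![0, 1, 4, 5, 2, 3, 6] (by decide) (by decide) 1 (by decide +kernel),
    key ![4, 5, 6] ![0, 1, 2, 3] ![0, 1, 2, 3, 4, 5, 6] (by decide) (by decide) 1 (by decide +kernel),
    key ![0, 2, 4] ![1, 3, 5, 6] ![4, 0, 5, 1, 6, 2, 3] (by decide) (by decide) (-1) (by decide +kernel),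
    key ![0, 3, 5] ![1, 2, 4, 6] ![4, 0, 1, 5, 2, 6, 3] (by decide) (by decide) (-1) (by decide +kernel),
    key ![1, 2, 5] ![0, 3, 4, 6] ![0, 4, 5, 1, 2, 6, 3] (by decide) (by decide) (-1) (by decide +kernel),
    key ![1, 3, 4] ![0, 2, 5, 6] ![0, 4, 1, 5, 6, 2, 3] (by decide) (by decide) (-1) (by decide +kernel)]
  simp only [hM]
  push_cast
  ring

theorem interior_apply_two (φ : Form W 3) (v x y : W) :
    interior v φ ![x, y] = φ ![v, x, y] := rfl

theorem phiForm_apply (E : Basis (Fin 7) ℂ W) (x y z : W) :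
    phiForm E ![x, y, z] = basisForm E ![0, 1, 6] ![x, y, z] + basisForm E ![2, 3, 6] ![x, y, z]
      + basisForm E ![4, 5, 6] ![x, y, z] + basisForm E ![0, 2, 4] ![x, y, z]
      - basisForm E ![0, 3, 5] ![x, y, z] - basisForm E ![1, 2, 5] ![x, y, z]
      - basisForm E ![1, 3, 4] ![x, y, z] := rfl

theorem psiForm_apply (E : Basis (Fin 7) ℂ W) (x y z w : W) :
    psiForm E ![x, y, z, w] = basisForm E ![2, 3, 4, 5] ![x, y, z, w]
      + basisForm E ![0, 1, 4, 5] ![x, y, z, w] + basisForm E ![0, 1, 2, 3] ![x, y, z, w]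
      - basisForm E ![1, 3, 5, 6] ![x, y, z, w] + basisForm E ![1, 2, 4, 6] ![x, y, z, w]
      + basisForm E ![0, 3, 4, 6] ![x, y, z, w] + basisForm E ![0, 2, 5, 6] ![x, y, z, w] := rfl

theorem coord_basis {n : ℕ} (E : Basis (Fin n) ℂ W) (i j : Fin n) :
    E.coord i (E j) = if i = j then 1 else 0 := by
  simp [Finsupp.single_apply, eq_comm]

theorem isInducedForm_orthoForm [FiniteDimensional ℂ W] (E : Basis (Fin 7) ℂ W) :
    IsInducedForm (phiForm E) (volForm E) (orthoForm E) := by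
  intro v w
  -- Stated for a general `b` because the degree `2 + 2 + 3` of the wedge is `7` only by unfolding.
  have key : ∀ b : Form W 7, topEval E b = 6 * orthoForm E v w →
      orthoForm E v w • volForm E = (1 / 6 : ℂ) • b := by
    intro b hb
    refine form_ext_basis E ?_
    rw [map_smul, map_smul, volForm_apply_basis, hb, smul_eq_mul, smul_eq_mul]
    ring
  apply key
  rw [wedge_phiForm_apply E]
  simp only [wedge_two_two_apply, interior_apply_two, phiForm_apply, basisForm_three_apply,
    orthoForm_apply, Fin.sum_univ_seven]
  simp only [coord_basis, Fin.reduceEq, if_true, if_false]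
  ring

/-- `formInner` as a bilinear map. -/
def formInnerₗ [FiniteDimensional ℂ W] (B : LinearMap.BilinForm ℂ W) (hB : B.Nondegenerate)
    (m : ℕ) : Form W m →ₗ[ℂ] Form W m →ₗ[ℂ] ℂ :=
  LinearMap.mk₂ ℂ (formInner B hB)
    (fun a a' c => by simp [formInner, add_mul, mul_add, Finset.sum_add_distrib])
    (fun r a c => by
      simp only [formInner, AlternatingMap.smul_apply, smul_eq_mul, mul_assoc, ← Finset.mul_sum]
      ring)
    (fun a c c' => by simp [formInner, mul_add, Finset.sum_add_distrib])
    (fun r a c => by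
      simp only [formInner, AlternatingMap.smul_apply, smul_eq_mul, mul_left_comm _ r,
        ← Finset.mul_sum])

/-- On the spanning flat decomposables the pairing is a Gram determinant, which is unchanged by
transposition when `B` is symmetric. -/
theorem formInner_comm [FiniteDimensional ℂ W] {B : LinearMap.BilinForm ℂ W}
    (hB : B.Nondegenerate) (hs : ∀ v w, B v w = B w v) {m : ℕ} (a c : Form W m) :
    formInner B hB a c = formInner B hB c a := by
  have h : formInnerₗ B hB m = (formInnerₗ B hB m).flip := by
    refine LinearMap.ext_on (span_covectorWedge_flat hB hs m) ?_
    rintro _ ⟨v, rfl⟩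
    refine LinearMap.ext_on (span_covectorWedge_flat hB hs m) ?_
    rintro _ ⟨w, rfl⟩
    change formInner B hB _ _ = formInner B hB _ _
    rw [formInner_flat, formInner_flat, ← Matrix.det_transpose]
    congr 1
    ext i j
    exact hs _ _
  exact LinearMap.congr_fun₂ h a c

theorem volForm_ne_zero (E : Basis (Fin 7) ℂ W) : volForm E ≠ 0 := by
  intro h
  have := volForm_apply_basis E
  rw [h, map_zero] at this
  exact zero_ne_one this

theorem IsInducedForm.eq_orthoForm [FiniteDimensional ℂ W] {E : Basis (Fin 7) ℂ W}
    {B : LinearMap.BilinForm ℂ W} (h : IsInducedForm (phiForm E) (volForm E) B) :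
    B = orthoForm E :=
  h.unique (volForm_ne_zero E) (isInducedForm_orthoForm E)

theorem formInner_basisForm_left [FiniteDimensional ℂ W] {n m : ℕ} (E : Basis (Fin n) ℂ W)
    (I : Fin m → Fin n) (χ : Form W m) :
    formInner (orthoForm E) (orthoForm_nondegenerate E) (basisForm E I) χ =
      χ fun k => E (I k) := by
  rw [← formInner_flat_left (orthoForm E) (orthoForm_nondegenerate E)]
  simp only [basisForm, orthoForm_basis_left]

/-- As `E` is orthonormal, pairing with `E^I` evaluates `χ` on `E_I`; both sides collect the same
seven signed values. -/
theorem phiForm_wedge_eq [FiniteDimensional ℂ W] (E : Basis (Fin 7) ℂ W) (χ : Form W 4) :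
    wedge (phiForm E) χ =
      formInner (orthoForm E) (orthoForm_nondegenerate E) (psiForm E) χ • volForm E := by
  have hI : ∀ a b c d : Fin 7, formInnerₗ (orthoForm E) (orthoForm_nondegenerate E) 4
      (basisForm E ![a, b, c, d]) χ = χ ![E a, E b, E c, E d] := by
    intro a b c d
    refine (formInner_basisForm_left E _ χ).trans (congrArg χ ?_)
    ext i
    fin_cases i <;> rfl
  have hr : formInner (orthoForm E) (orthoForm_nondegenerate E) (psiForm E) χ =
      χ ![E 2, E 3, E 4, E 5] + χ ![E 0, E 1, E 4, E 5]
      + χ ![E 0, E 1, E 2, E 3] - χ ![E 1, E 3, E 5, E 6] + χ ![E 1, E 2, E 4, E 6]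
      + χ ![E 0, E 3, E 4, E 6] + χ ![E 0, E 2, E 5, E 6] := by
    change formInnerₗ (orthoForm E) (orthoForm_nondegenerate E) 4 (psiForm E) χ = _
    rw [psiForm]
    simp only [map_add, map_sub, LinearMap.add_apply, LinearMap.sub_apply, hI]
  have key : ∀ b : Form W 7,
      topEval E b = formInner (orthoForm E) (orthoForm_nondegenerate E) (psiForm E) χ →
      b = formInner (orthoForm E) (orthoForm_nondegenerate E) (psiForm E) χ • volForm E := by
    intro b hb
    refine form_ext_basis E ?_
    rw [map_smul, volForm_apply_basis, hb, smul_eq_mul, mul_one]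
  apply key
  rw [phiForm_wedge_apply E, hr]

/-- The bilinear form is forced, and pairing against flat decomposables recovers every value of a
form, so the dual is unique. -/
theorem isHodgeDual_phiForm_iff [FiniteDimensional ℂ W] (E : Basis (Fin 7) ℂ W) (Ψ : Form W 4) :
    IsHodgeDual (phiForm E) (volForm E) Ψ ↔ Ψ = psiForm E := by
  constructor
  · rintro ⟨B, hB, hind, hχ⟩
    obtain rfl := hind.eq_orthoForm
    ext v
    have h : ∀ χ, formInner (orthoForm E) hB Ψ χ = formInner (orthoForm E) hB (psiForm E) χ :=
      fun χ => smul_left_injective ℂ (volForm_ne_zero E)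
        ((hχ χ).symm.trans (phiForm_wedge_eq E χ))
    rw [← formInner_flat_left _ hB, ← formInner_flat_left _ hB,
      formInner_comm hB (orthoForm_comm E), h, formInner_comm hB (orthoForm_comm E)]
  · rintro rfl
    exact ⟨orthoForm E, orthoForm_nondegenerate E, isInducedForm_orthoForm E,
      phiForm_wedge_eq E⟩

end Forms

/-! ### The exterior derivative when the bracket comes from one endomorphism -/

section LieAlgebra

variable {𝔤 : Type*} [LieRing 𝔤] [LieAlgebra ℂ 𝔤]

theorem isCocalibratedG2Structure_iff [FiniteDimensional ℂ 𝔤] (φ : Form 𝔤 3) (vol : Form 𝔤 7) :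
    IsCocalibratedG2Structure φ vol ↔ ∃ E : Basis (Fin 7) ℂ 𝔤,
      φ = phiForm E ∧ vol = volForm E ∧ lieExtDeriv (psiForm E) = 0 := by
  constructor
  · rintro ⟨⟨E, hv, hφ⟩, Ψ, hΨ, hd⟩
    change vol = volForm E at hv
    change φ = phiForm E at hφ
    subst hv hφ
    rw [isHodgeDual_phiForm_iff] at hΨ
    subst hΨ
    exact ⟨E, rfl, rfl, hd⟩
  · rintro ⟨E, rfl, rfl, hd⟩
    exact ⟨⟨E, rfl, rfl⟩, psiForm E, (isHodgeDual_phiForm_iff E _).2 rfl, hd⟩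

/-- The derivation action of an endomorphism `F` on four-forms, up to sign. -/
def formAction {W : Type*} [AddCommGroup W] [Module ℂ W] (F : End ℂ W) (Ψ : Form W 4)
    (x y z w : W) : ℂ :=
  Ψ ![F x, y, z, w] - Ψ ![F y, x, z, w] + Ψ ![F z, x, y, w] - Ψ ![F w, x, y, z]

/-- Inserting the bracket `α ∧ F` into the Chevalley–Eilenberg sum and grouping by the argument fed
to `α` gives `dΨ = -α ∧ (F·Ψ)`. -/
theorem lieExtDeriv_eq (α : Dual ℂ 𝔤) (F : End ℂ 𝔤)
    (hF : ∀ x y : 𝔤, ⁅x, y⁆ = α x • F y - α y • F x) (Ψ : Form 𝔤 4) (X : Fin 5 → 𝔤) :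
    lieExtDeriv Ψ X = -(α (X 0) * formAction F Ψ (X 1) (X 2) (X 3) (X 4)
      - α (X 1) * formAction F Ψ (X 0) (X 2) (X 3) (X 4)
      + α (X 2) * formAction F Ψ (X 0) (X 1) (X 3) (X 4)
      - α (X 3) * formAction F Ψ (X 0) (X 1) (X 2) (X 4)
      + α (X 4) * formAction F Ψ (X 0) (X 1) (X 2) (X 3)) := by
  have hc : ∀ (x y a b c : 𝔤), Ψ ![⁅x, y⁆, a, b, c] =
      α x * Ψ ![F y, a, b, c] - α y * Ψ ![F x, a, b, c] := by
    intro x y a b c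
    have h := map_sub (Ψ.curryLeft) (α x • F y) (α y • F x)
    rw [map_smul, map_smul] at h
    rw [hF]
    exact DFunLike.congr_fun h ![a, b, c]
  have hr : ∀ (i : Fin 4) (j : Fin 5) (u : 𝔤),
      (Fin.cons u (i.removeNth (j.removeNth X)) : Fin 4 → 𝔤) =
      ![u, X (j.succAbove (i.succAbove 0)), X (j.succAbove (i.succAbove 1)),
        X (j.succAbove (i.succAbove 2))] := by
    intro i j u
    ext k
    fin_cases k <;> rfl
  have he : lieExtDeriv Ψ X = ∑ i : Fin 4, ∑ j : Fin 5, if i.castSucc < j then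
      (-1) ^ ((i : ℕ) + (j : ℕ)) *
        Ψ (Fin.cons ⁅X i.castSucc, X j⁆ (i.removeNth (j.removeNth X))) else 0 := rfl
  rw [he]
  simp only [hr, hc, Fin.sum_univ_four, Fin.sum_univ_five, formAction]
  simp
  simp only [show Fin.succAbove (1 : Fin 5) 2 = 3 from rfl, show Fin.succAbove (1 : Fin 5) 3 = 4 from rfl,
    show Fin.succAbove (2 : Fin 5) 1 = 1 from rfl, show Fin.succAbove (2 : Fin 5) 2 = 3 from rfl,
    show Fin.succAbove (2 : Fin 5) 3 = 4 from rfl, show Fin.succAbove (3 : Fin 5) 1 = 1 from rfl,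
    show Fin.succAbove (3 : Fin 5) 2 = 2 from rfl, show Fin.succAbove (3 : Fin 5) 3 = 4 from rfl,
    show Fin.succAbove (4 : Fin 5) 1 = 1 from rfl, show Fin.succAbove (4 : Fin 5) 2 = 2 from rfl,
    show Fin.succAbove (4 : Fin 5) 3 = 3 from rfl, show Fin.succAbove (1 : Fin 4) 2 = 3 from rfl,
    show Fin.succAbove (2 : Fin 4) 1 = 1 from rfl, show Fin.succAbove (2 : Fin 4) 2 = 3 from rfl,
    show Fin.succAbove (3 : Fin 4) 1 = 1 from rfl, show Fin.succAbove (3 : Fin 4) 2 = 2 from rfl]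
  ring

end LieAlgebra

section LieAlgebra

variable {𝔤 : Type*} [LieRing 𝔤] [LieAlgebra ℂ 𝔤]

theorem formAction_eq_alternatizeUncurryFin {W : Type*} [AddCommGroup W] [Module ℂ W]
    (F : End ℂ W) (Ψ : Form W 4) (v : Fin 4 → W) :
    AlternatingMap.alternatizeUncurryFin (Ψ.curryLeft ∘ₗ F) v =
      formAction F Ψ (v 0) (v 1) (v 2) (v 3) := by
  have hr : ∀ i : Fin 4, i.removeNth v =
      ![v (i.succAbove 0), v (i.succAbove 1), v (i.succAbove 2)] := by
    intro i
    ext k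
    fin_cases k <;> rfl
  have hc : ∀ x a b c : W, (Ψ.curryLeft ∘ₗ F) x ![a, b, c] = Ψ ![F x, a, b, c] :=
    fun _ _ _ _ => rfl
  rw [AlternatingMap.alternatizeUncurryFin_apply]
  refine (Fin.sum_univ_four _).trans ?_
  simp only [hr, hc, formAction]
  simp
  simp only [show Fin.succAbove (1 : Fin 4) 2 = 3 from rfl,
    show Fin.succAbove (2 : Fin 4) 1 = 1 from rfl, show Fin.succAbove (2 : Fin 4) 2 = 3 from rfl,
    show Fin.succAbove (3 : Fin 4) 1 = 1 from rfl, show Fin.succAbove (3 : Fin 4) 2 = 2 from rfl]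
  ring

/-- This is `α ∧ Θ = 0`, tested on distinct vectors of a basis made of `e` and a basis of `ker α`. A
summand with a kernel vector in `α` vanishes; if `e` is in `α`, the remaining vectors are kernel
vectors and `Θ` vanishes. -/
theorem alternatizeUncurryFin_eq_zero_of_ker {W : Type*} [AddCommGroup W] [Module ℂ W]
    {α : Dual ℂ W} {e : W} (he : α e = 1) {m : ℕ} {Θ : Form W m}
    (hΘ : ∀ v : Fin m → W, (∀ i, α (v i) = 0) → Θ v = 0) :
    AlternatingMap.alternatizeUncurryFin (α.smulRight Θ) = 0 := by
  classical
  obtain ⟨⟨κ, b⟩⟩ : Nonempty (Σ κ : Set (LinearMap.ker α), Basis κ ℂ (LinearMap.ker α)) :=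
    ⟨⟨_, Basis.ofVectorSpace ℂ _⟩⟩
  let f : Option κ → W := fun o => o.elim e fun k => (b k : W)
  have hfk : ∀ k, α (f (some k)) = 0 := fun k => (b k).2
  have hli : LinearIndependent ℂ f := by
    rw [linearIndependent_option]
    refine ⟨b.linearIndependent.map' (LinearMap.ker α).subtype (Submodule.ker_subtype _), ?_⟩
    intro h
    have hle : Submodule.span ℂ (Set.range (f ∘ some)) ≤ LinearMap.ker α := by
      rw [Submodule.span_le]
      rintro _ ⟨k, rfl⟩
      exact hfk k
    have := hle h
    rw [LinearMap.mem_ker] at this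
    exact one_ne_zero (he.symm.trans this)
  have hsp : ⊤ ≤ Submodule.span ℂ (Set.range f) := by
    intro x _
    have hx : x - α x • e ∈ LinearMap.ker α := by simp [he]
    have h1 : ((LinearMap.ker α).subtype ⟨_, hx⟩) ∈
        Submodule.map (LinearMap.ker α).subtype (Submodule.span ℂ (Set.range b)) := by
      rw [b.span_eq]
      exact Submodule.mem_map_of_mem trivial
    rw [← Submodule.span_image, ← Set.range_comp] at h1
    have h2 : x - α x • e ∈ Submodule.span ℂ (Set.range f) :=
      Submodule.span_mono (by rintro _ ⟨k, rfl⟩; exact ⟨some k, rfl⟩) h1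
    have h3 : α x • e ∈ Submodule.span ℂ (Set.range f) :=
      Submodule.smul_mem _ _ (Submodule.subset_span ⟨none, rfl⟩)
    simpa using Submodule.add_mem _ h2 h3
  refine Basis.ext_alternating (Basis.mk hli hsp) fun I hI => ?_
  rw [AlternatingMap.alternatizeUncurryFin_apply, AlternatingMap.zero_apply]
  refine Finset.sum_eq_zero fun k _ => ?_
  simp only [Basis.coe_mk, LinearMap.smulRight_apply, AlternatingMap.smul_apply]
  rcases hk : I k with _ | j
  · rw [hΘ, smul_zero, smul_zero]
    intro i
    change α (f (I (k.succAbove i))) = 0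
    rcases hj : I (k.succAbove i) with _ | j
    · exact absurd (hI (hj.trans hk.symm)) (Fin.succAbove_ne k i)
    · exact hfk j
  · rw [hfk, zero_smul, smul_zero]

theorem lieExtDeriv_eq_zero_of_ker {α : Dual ℂ 𝔤} {F : End ℂ 𝔤} {e : 𝔤} (he : α e = 1)
    (hF : ∀ x y : 𝔤, ⁅x, y⁆ = α x • F y - α y • F x) {Ψ : Form 𝔤 4}
    (h : ∀ x y z w : 𝔤, α x = 0 → α y = 0 → α z = 0 → α w = 0 → formAction F Ψ x y z w = 0) :
    lieExtDeriv Ψ = 0 := by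
  funext X
  rw [lieExtDeriv_eq α F hF]
  have h0 := alternatizeUncurryFin_eq_zero_of_ker he
    (Θ := AlternatingMap.alternatizeUncurryFin (Ψ.curryLeft ∘ₗ F)) fun v hv => by
      rw [formAction_eq_alternatizeUncurryFin]
      exact h _ _ _ _ (hv 0) (hv 1) (hv 2) (hv 3)
  have h1 := DFunLike.congr_fun h0 X
  rw [AlternatingMap.alternatizeUncurryFin_apply] at h1
  replace h1 := (Fin.sum_univ_five _).symm.trans h1
  simp only [LinearMap.smulRight_apply, AlternatingMap.smul_apply,
    formAction_eq_alternatizeUncurryFin, Fin.removeNth] at h1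
  simp only [show ∀ k : Fin 4, Fin.succAbove (0 : Fin 5) k = k.succ from fun _ => rfl,
    show Fin.succAbove (1 : Fin 5) 0 = 0 from rfl, show Fin.succAbove (1 : Fin 5) 1 = 2 from rfl,
    show Fin.succAbove (1 : Fin 5) 2 = 3 from rfl, show Fin.succAbove (1 : Fin 5) 3 = 4 from rfl,
    show Fin.succAbove (2 : Fin 5) 0 = 0 from rfl, show Fin.succAbove (2 : Fin 5) 1 = 1 from rfl,
    show Fin.succAbove (2 : Fin 5) 2 = 3 from rfl, show Fin.succAbove (2 : Fin 5) 3 = 4 from rfl,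
    show Fin.succAbove (3 : Fin 5) 0 = 0 from rfl, show Fin.succAbove (3 : Fin 5) 1 = 1 from rfl,
    show Fin.succAbove (3 : Fin 5) 2 = 2 from rfl, show Fin.succAbove (3 : Fin 5) 3 = 4 from rfl,
    show Fin.succAbove (4 : Fin 5) 0 = 0 from rfl, show Fin.succAbove (4 : Fin 5) 1 = 1 from rfl,
    show Fin.succAbove (4 : Fin 5) 2 = 2 from rfl, show Fin.succAbove (4 : Fin 5) 3 = 3 from rfl]
    at h1
  simp at h1
  rw [Pi.zero_apply]
  linear_combination -h1

end LieAlgebra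

/-! ### Symplectic linear algebra and traces -/

section Symplectic

theorem mem_skewAdjointLieSubalgebra_iff {V : Type*} [AddCommGroup V] [Module ℂ V]
    (ω : LinearMap.BilinForm ℂ V) (f : End ℂ V) :
    f ∈ skewAdjointLieSubalgebra ω ↔ ∀ x y, ω (f x) y + ω x (f y) = 0 := by
  change f ∈ LinearMap.skewAdjointSubmodule ω ↔ _
  rw [LinearMap.mem_skewAdjointSubmodule]
  refine forall₂_congr fun x y => ?_
  rw [Pi.neg_apply, map_neg, eq_neg_iff_add_eq_zero]

/-- The orthogonal complement of a pair of vectors for a bilinear form. -/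
def pairPerp {V : Type*} [AddCommGroup V] [Module ℂ V] (ω : LinearMap.BilinForm ℂ V) (e f : V) :
    Submodule ℂ V := LinearMap.ker (ω e) ⊓ LinearMap.ker (ω f)

/-- A hyperbolic pair splits off. -/
def hyperbolicSplit {V : Type*} [AddCommGroup V] [Module ℂ V] (ω : LinearMap.BilinForm ℂ V)
    (hω : ω.IsAlt) (e f : V) (h : ω e f = 1) : V ≃ₗ[ℂ] (ℂ × ℂ) × pairPerp ω e f where
  toFun x := ((-ω f x, ω e x), ⟨x + ω f x • e - ω e x • f, by
    have h1 : ω f e = -1 := by rw [← hω.neg_eq, h]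
    have h2 : ω e e = 0 := hω e
    have h3 : ω f f = 0 := hω f
    simp [pairPerp, h, h1, h2, h3]⟩)
  map_add' x y := by
    ext
    · simp; ring
    · simp
    · simp; module
  map_smul' c x := by
    ext
    · simp
    · simp
    · simp; module
  invFun p := p.1.1 • e + p.1.2 • f + p.2
  left_inv x := by simp
  right_inv p := by
    obtain ⟨⟨a, b⟩, k, hk⟩ := p
    have h1 : ω f e = -1 := by rw [← hω.neg_eq, h]
    have h2 : ω e e = 0 := hω e
    have h3 : ω f f = 0 := hω f
    obtain ⟨hk1, hk2⟩ := Submodule.mem_inf.1 hk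
    rw [LinearMap.mem_ker] at hk1 hk2
    ext
    · simp [h1, h3, hk2]
    · simp [h, h2, hk1]
    · simp [h, h1, h2, h3, hk1, hk2]
      abel

theorem hyperbolicSplit_form {V : Type*} [AddCommGroup V] [Module ℂ V]
    (ω : LinearMap.BilinForm ℂ V) (hω : ω.IsAlt) (e f : V) (h : ω e f = 1) (x y : V) :
    ω x y = (hyperbolicSplit ω hω e f h x).1.1 * (hyperbolicSplit ω hω e f h y).1.2
      - (hyperbolicSplit ω hω e f h x).1.2 * (hyperbolicSplit ω hω e f h y).1.1
      + ω (hyperbolicSplit ω hω e f h x).2 (hyperbolicSplit ω hω e f h y).2 := by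
  have h1 : ω f e = -1 := by rw [← hω.neg_eq, h]
  have h2 : ω e e = 0 := hω e
  have h3 : ω f f = 0 := hω f
  have h4 : ω x e = -ω e x := (hω.neg_eq e x).symm
  have h5 : ω x f = -ω f x := (hω.neg_eq f x).symm
  simp [hyperbolicSplit, h, h1, h2, h3, h4, h5]
  ring

theorem exists_hyperbolic_pair {V : Type*} [AddCommGroup V] [Module ℂ V] [Nontrivial V]
    {ω : LinearMap.BilinForm ℂ V} (hn : ω.Nondegenerate) : ∃ e f, ω e f = 1 := by
  obtain ⟨e, he⟩ := exists_ne (0 : V)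
  have : ∃ f, ω e f ≠ 0 := by
    by_contra! hc
    exact he (hn.1 e hc)
  obtain ⟨f, hf⟩ := this
  exact ⟨e, (ω e f)⁻¹ • f, by simp [hf]⟩

theorem nondegenerate_pairPerp {V : Type*} [AddCommGroup V] [Module ℂ V]
    {ω : LinearMap.BilinForm ℂ V} (hω : ω.IsAlt) (hn : ω.Nondegenerate) {e f : V}
    (h : ω e f = 1) : (ω.restrict (pairPerp ω e f)).Nondegenerate := by
  have hl : ∀ x : pairPerp ω e f, (∀ y : pairPerp ω e f, ω x y = 0) → x = 0 := by
    intro x hx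
    obtain ⟨hk1, hk2⟩ := Submodule.mem_inf.1 x.2
    rw [LinearMap.mem_ker] at hk1 hk2
    refine Subtype.ext (hn.1 _ fun y => ?_)
    rw [hyperbolicSplit_form ω hω e f h]
    have h1 : (hyperbolicSplit ω hω e f h x).2 = x := by
      ext; simp [hyperbolicSplit, hk1, hk2]
    rw [h1, hx]
    simp [hyperbolicSplit, hk1, hk2]
  refine ⟨hl, fun x hx => hl x fun y => ?_⟩
  rw [← hω.neg_eq]
  exact neg_eq_zero.2 (hx y)

/-- Split a hyperbolic plane off both spaces and recurse on the complements. The spaces are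
quantified inside the induction because they change at each step. -/
theorem exists_symplectic_equiv_aux (d : ℕ) : ∀ {V : Type*} {V' : Type*} [AddCommGroup V]
    [Module ℂ V] [FiniteDimensional ℂ V] [AddCommGroup V'] [Module ℂ V'] [FiniteDimensional ℂ V']
    {ω : LinearMap.BilinForm ℂ V} {ω' : LinearMap.BilinForm ℂ V'} (_ : ω.IsAlt) (_ : ω'.IsAlt)
    (_ : ω.Nondegenerate) (_ : ω'.Nondegenerate) (_ : finrank ℂ V = d) (_ : finrank ℂ V' = d),
    ∃ T : V ≃ₗ[ℂ] V', ∀ x y, ω' (T x) (T y) = ω x y := by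
  induction d using Nat.strong_induction_on with
  | _ d ih =>
    intro V V' _ _ _ _ _ _ ω ω' hω hω' hn hn' hd hd'
    rcases Nat.eq_zero_or_pos d with rfl | hpos
    · refine ⟨LinearEquiv.ofFinrankEq V V' (hd.trans hd'.symm), fun x y => ?_⟩
      have := Module.finrank_zero_iff.1 hd
      rw [Subsingleton.elim x 0]
      simp
    · have : Nontrivial V := Module.finrank_pos_iff.1 (hd ▸ hpos)
      have : Nontrivial V' := Module.finrank_pos_iff.1 (hd' ▸ hpos)
      obtain ⟨e, f, h⟩ := exists_hyperbolic_pair hn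
      obtain ⟨e', f', h'⟩ := exists_hyperbolic_pair hn'
      have hk := (hyperbolicSplit ω hω e f h).finrank_eq
      have hk' := (hyperbolicSplit ω' hω' e' f' h').finrank_eq
      rw [hd, Module.finrank_prod, Module.finrank_prod, Module.finrank_self] at hk
      rw [hd', Module.finrank_prod, Module.finrank_prod, Module.finrank_self] at hk'
      obtain ⟨T, hT⟩ := ih (d - 2) (by omega) (ω := ω.restrict (pairPerp ω e f))
        (ω' := ω'.restrict (pairPerp ω' e' f')) (fun x => hω x) (fun x => hω' x)
        (nondegenerate_pairPerp hω hn h) (nondegenerate_pairPerp hω' hn' h')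
        (by omega) (by omega)
      refine ⟨(hyperbolicSplit ω hω e f h).trans (((LinearEquiv.refl ℂ (ℂ × ℂ)).prodCongr T).trans
        (hyperbolicSplit ω' hω' e' f' h').symm), fun x y => ?_⟩
      rw [hyperbolicSplit_form ω' hω' e' f' h', hyperbolicSplit_form ω hω e f h]
      simp only [LinearEquiv.trans_apply, LinearEquiv.apply_symm_apply]
      congr 1
      exact hT _ _

theorem exists_symplectic_equiv {V : Type*} {V' : Type*} [AddCommGroup V]
    [Module ℂ V] [FiniteDimensional ℂ V] [AddCommGroup V'] [Module ℂ V'] [FiniteDimensional ℂ V']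
    {ω : LinearMap.BilinForm ℂ V} {ω' : LinearMap.BilinForm ℂ V'} (hω : ω.IsAlt) (hω' : ω'.IsAlt)
    (hn : ω.Nondegenerate) (hn' : ω'.Nondegenerate) (hd : finrank ℂ V = finrank ℂ V') :
    ∃ T : V ≃ₗ[ℂ] V', ∀ x y, ω' (T x) (T y) = ω x y :=
  exists_symplectic_equiv_aux _ hω hω' hn hn' hd rfl

/-- Through the isomorphism `V ≃ V*` given by `ω`, `f` is conjugate to minus its transpose, so its
trace equals its negative. -/
theorem trace_eq_zero_of_skew {V : Type*} [AddCommGroup V] [Module ℂ V] [FiniteDimensional ℂ V]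
    {ω : LinearMap.BilinForm ℂ V} (hn : ω.Nondegenerate) {f : End ℂ V}
    (hf : ∀ x y, ω (f x) y + ω x (f y) = 0) : LinearMap.trace ℂ V f = 0 := by
  have h : (LinearMap.BilinForm.toDual ω hn).conj f = -Module.Dual.transpose (R := ℂ) f := by
    ext φ y
    obtain ⟨x, rfl⟩ := (LinearMap.BilinForm.toDual ω hn).surjective φ
    have := hf x y
    simp [LinearEquiv.conj_apply, LinearMap.BilinForm.toDual_def, Module.Dual.transpose_apply]
    linear_combination this
  have h2 := congrArg (LinearMap.trace ℂ _) h
  rw [LinearMap.trace_conj', map_neg, LinearMap.trace_transpose'] at h2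
  exact self_eq_neg.1 h2

theorem trace_of_conformal {V : Type*} [AddCommGroup V] [Module ℂ V] [FiniteDimensional ℂ V]
    {ω : LinearMap.BilinForm ℂ V} (hn : ω.Nondegenerate) {f : End ℂ V} {c : ℂ}
    (hf : ∀ x y, ω (f x) y + ω x (f y) = c * ω x y) :
    LinearMap.trace ℂ V f = c / 2 * finrank ℂ V := by
  have h := trace_eq_zero_of_skew hn (f := f - (c / 2) • LinearMap.id) fun x y => by
    simp
    linear_combination hf x y
  rw [map_sub, map_smul, LinearMap.trace_id, sub_eq_zero] at h
  rw [h, smul_eq_mul]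

/-- The conformal factor is the trace itself, so in dimension six `tr f = 3 tr f`. Hence the trace
vanishes, `f` is skew for `ω`, and `ω` can be carried to `ω₆`. -/
theorem isSimilarToElementOf_skewAdjoint {U : Type*} [AddCommGroup U] [Module ℂ U]
    [FiniteDimensional ℂ U] (hU : finrank ℂ U = 6) {f : End ℂ U} {ω ω₆ : LinearMap.BilinForm ℂ U}
    (hω : ω.IsAlt) (hn : ω.Nondegenerate) (hω₆ : ω₆.IsAlt) (hn₆ : ω₆.Nondegenerate)
    (hf : ∀ x y, ω (f x) y + ω x (f y) = LinearMap.trace ℂ U f * ω x y) :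
    IsSimilarToElementOf f (skewAdjointLieSubalgebra ω₆) := by
  have ht : LinearMap.trace ℂ U f = 0 := by
    have h := trace_of_conformal hn hf
    rw [hU] at h
    push_cast at h
    linear_combination -h / 2
  obtain ⟨T, hT⟩ := exists_symplectic_equiv hω hω₆ hn hn₆ rfl
  refine ⟨T, ?_⟩
  rw [SetLike.mem_coe, mem_skewAdjointLieSubalgebra_iff]
  intro x y
  obtain ⟨x, rfl⟩ := T.surjective x
  obtain ⟨y, rfl⟩ := T.surjective y
  simp only [LinearEquiv.conj_apply_apply, LinearEquiv.symm_apply_apply, hT, hf, ht, zero_mul]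

theorem projectionOnto_add_projectionOnto {U : Type*} [AddCommGroup U] [Module ℂ U]
    {V₂ V₄ : Submodule ℂ U} (hV : IsCompl V₂ V₄) (x : U) :
    (V₂.projectionOnto V₄ hV x : U) + V₄.projectionOnto V₂ hV.symm x = x := by
  rw [Submodule.coe_projectionOnto_apply, Submodule.coe_projectionOnto_apply]
  exact Submodule.projection_add_projection_eq_self hV x

theorem trace_eq_add_of_isCompl {U : Type*} [AddCommGroup U] [Module ℂ U]
    [FiniteDimensional ℂ U] {V₂ V₄ : Submodule ℂ U} (hV : IsCompl V₂ V₄) (g : End ℂ U) :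
    LinearMap.trace ℂ U g =
      LinearMap.trace ℂ V₂ (V₂.projectionOnto V₄ hV ∘ₗ g ∘ₗ V₂.subtype)
      + LinearMap.trace ℂ V₄ (V₄.projectionOnto V₂ hV.symm ∘ₗ g ∘ₗ V₄.subtype) := by
  rw [← LinearMap.trace_comp_comm' (V₂.projectionOnto V₄ hV) (g ∘ₗ V₂.subtype),
    ← LinearMap.trace_comp_comm' (V₄.projectionOnto V₂ hV.symm) (g ∘ₗ V₄.subtype), ← map_add]
  congr 1
  ext x
  simp only [LinearMap.add_apply, LinearMap.comp_apply, Submodule.subtype_apply]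
  rw [← map_add, projectionOnto_add_projectionOnto hV]

/-- With `t = tr f`, the trace on the four-dimensional invariant `S` is `2t`, leaving `-t` for the
complementary block. The scalar part `t / 2` on `S` is then minus half the trace of that block. Any
complement of `S` serves, as the off-diagonal part is unrestricted. -/
theorem isSimilarToElementOf_lengthTwoStabilizer {U : Type*} [AddCommGroup U] [Module ℂ U]
    [FiniteDimensional ℂ U] {f : End ℂ U} {V₂ V₄ S : Submodule ℂ U}
    (hV₄ : finrank ℂ V₄ = 4) (hV : IsCompl V₂ V₄) {ω₄ : LinearMap.BilinForm ℂ V₄}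
    (hω₄ : ω₄.IsAlt) (hn₄ : ω₄.Nondegenerate) (hS : finrank ℂ S = 4)
    {τ : LinearMap.BilinForm ℂ S} (hτ : τ.IsAlt) (hn : τ.Nondegenerate) {fS : End ℂ S}
    (hfS : ∀ x : S, f x = fS x)
    (hf : ∀ x y, τ (fS x) y + τ x (fS y) = LinearMap.trace ℂ U f * τ x y) :
    IsSimilarToElementOf f (lengthTwoStabilizer V₂ V₄ ω₄) := by
  obtain ⟨S', hSS'⟩ := S.exists_isCompl
  obtain ⟨T₄, hT₄⟩ := exists_symplectic_equiv hτ hω₄ hn hn₄ (hS.trans hV₄.symm)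
  have h1 := Submodule.finrank_add_eq_of_isCompl hSS'
  have h2 := Submodule.finrank_add_eq_of_isCompl hV
  let T₂ : S' ≃ₗ[ℂ] V₂ := LinearEquiv.ofFinrankEq _ _ (by omega)
  let T : U ≃ₗ[ℂ] U := (Submodule.prodEquivOfIsCompl S S' hSS').symm.trans
    ((T₄.prodCongr T₂).trans (Submodule.prodEquivOfIsCompl V₄ V₂ hV.symm))
  have hTS : ∀ x : S, T x = T₄ x := by
    intro x
    simp [T]
  set g := T.conj f with hg
  set t := LinearMap.trace ℂ U f with ht
  have hgt : LinearMap.trace ℂ U g = t := LinearMap.trace_conj' f T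
  have hg4 : ∀ x : V₄, g x = T₄ (fS (T₄.symm x)) := by
    intro x
    obtain ⟨x, rfl⟩ := T₄.surjective x
    rw [hg, ← hTS, LinearEquiv.conj_apply_apply, LinearEquiv.symm_apply_apply, hfS, hTS,
      LinearEquiv.symm_apply_apply]
  set g₄ : End ℂ V₄ := T₄.conj fS with hg₄
  have hg4' : ∀ x : V₄, g x = g₄ x := hg4
  have hconf : ∀ x y, ω₄ (g₄ x) y + ω₄ x (g₄ y) = t * ω₄ x y := by
    intro x y
    obtain ⟨x, rfl⟩ := T₄.surjective x
    obtain ⟨y, rfl⟩ := T₄.surjective y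
    simp only [hg₄, LinearEquiv.conj_apply_apply, LinearEquiv.symm_apply_apply, hT₄, hf]
  set f₂ : End ℂ V₂ := V₂.projectionOnto V₄ hV ∘ₗ g ∘ₗ V₂.subtype with hf₂
  have htr : LinearMap.trace ℂ V₂ f₂ = -t := by
    have h3 := trace_eq_add_of_isCompl hV g
    have h4 : V₄.projectionOnto V₂ hV.symm ∘ₗ g ∘ₗ V₄.subtype = g₄ := by
      ext x
      simp [hg4']
    rw [h4, trace_of_conformal hn₄ hconf, hV₄, hgt] at h3
    push_cast at h3
    linear_combination -h3
  refine ⟨T, f₂, V₄.projectionOnto V₂ hV.symm ∘ₗ g ∘ₗ V₂.subtype,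
    g₄ - (t / 2) • LinearMap.id, ?_, ?_, ?_⟩
  · rw [mem_skewAdjointLieSubalgebra_iff]
    intro x y
    simp
    linear_combination hconf x y
  · intro v
    exact (projectionOnto_add_projectionOnto hV (g v)).symm
  · intro v
    rw [← hg, hg4', htr]
    simp
    module

/-- The standard symplectic form on `ℂ⁴`. -/
def stdSymp₄ : LinearMap.BilinForm ℂ (Fin 4 → ℂ) :=
  LinearMap.mk₂ ℂ (fun x y => x 0 * y 1 - x 1 * y 0 + (x 2 * y 3 - x 3 * y 2))
    (fun _ _ _ => by simp; ring) (fun _ _ _ => by simp; ring) (fun _ _ _ => by simp; ring)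
    (fun _ _ _ => by simp; ring)

/-- The standard symplectic form on `ℂ⁶`. -/
def stdSymp₆ : LinearMap.BilinForm ℂ (Fin 6 → ℂ) :=
  LinearMap.mk₂ ℂ (fun x y => x 0 * y 1 - x 1 * y 0 + (x 2 * y 3 - x 3 * y 2)
      + (x 4 * y 5 - x 5 * y 4))
    (fun _ _ _ => by simp; ring) (fun _ _ _ => by simp; ring) (fun _ _ _ => by simp; ring)
    (fun _ _ _ => by simp; ring)

theorem stdSymp₄_isAlt : stdSymp₄.IsAlt := fun x => by simp [stdSymp₄]; ring

theorem stdSymp₆_isAlt : stdSymp₆.IsAlt := fun x => by simp [stdSymp₆]; ring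

theorem nondegenerate_of_isAlt {V : Type*} [AddCommGroup V] [Module ℂ V]
    {ω : LinearMap.BilinForm ℂ V} (hω : ω.IsAlt) (h : ∀ x, (∀ y, ω x y = 0) → x = 0) :
    ω.Nondegenerate :=
  ⟨h, fun x hx => h x fun y => by rw [← hω.neg_eq]; exact neg_eq_zero.2 (hx y)⟩

theorem stdSymp₄_nondegenerate : stdSymp₄.Nondegenerate := by
  refine nondegenerate_of_isAlt stdSymp₄_isAlt fun x hx => ?_
  have h0 := hx (Pi.single 0 1)
  have h1 := hx (Pi.single 1 1)
  have h2 := hx (Pi.single 2 1)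
  have h3 := hx (Pi.single 3 1)
  simp [stdSymp₄] at h0 h1 h2 h3
  ext i
  fin_cases i <;> simp [h0, h1, h2, h3]

theorem stdSymp₆_nondegenerate : stdSymp₆.Nondegenerate := by
  refine nondegenerate_of_isAlt stdSymp₆_isAlt fun x hx => ?_
  have h0 := hx (Pi.single 0 1)
  have h1 := hx (Pi.single 1 1)
  have h2 := hx (Pi.single 2 1)
  have h3 := hx (Pi.single 3 1)
  have h4 := hx (Pi.single 4 1)
  have h5 := hx (Pi.single 5 1)
  simp [stdSymp₆] at h0 h1 h2 h3 h4 h5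
  ext i
  fin_cases i <;> simp [h0, h1, h2, h3, h4, h5]

theorem exists_coordinates_of_skewAdjoint {U : Type*} [AddCommGroup U] [Module ℂ U]
    [FiniteDimensional ℂ U] (hU : finrank ℂ U = 6) {f : End ℂ U} {ω₆ : LinearMap.BilinForm ℂ U}
    (hω₆ : ω₆.IsAlt) (hn₆ : ω₆.Nondegenerate)
    (h : IsSimilarToElementOf f (skewAdjointLieSubalgebra ω₆)) :
    ∃ T : U ≃ₗ[ℂ] (Fin 6 → ℂ), ∀ x y,
      stdSymp₆ (T (f x)) (T y) + stdSymp₆ (T x) (T (f y)) = 0 := by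
  obtain ⟨S, hS⟩ := h
  rw [SetLike.mem_coe, mem_skewAdjointLieSubalgebra_iff] at hS
  obtain ⟨T, hT⟩ := exists_symplectic_equiv hω₆ stdSymp₆_isAlt hn₆ stdSymp₆_nondegenerate
    (by rw [hU]; simp)
  refine ⟨S.trans T, fun x y => ?_⟩
  have := hS (S x) (S y)
  simp only [LinearEquiv.conj_apply_apply, LinearEquiv.symm_apply_apply] at this
  simp only [LinearEquiv.trans_apply, hT, this]

theorem exists_coordinates_of_lengthTwoStabilizer {U : Type*} [AddCommGroup U] [Module ℂ U]
    [FiniteDimensional ℂ U] {f : End ℂ U} {V₂ V₄ : Submodule ℂ U} (hV₂ : finrank ℂ V₂ = 2)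
    (hV₄ : finrank ℂ V₄ = 4) (hV : IsCompl V₂ V₄) {ω₄ : LinearMap.BilinForm ℂ V₄}
    (hω₄ : ω₄.IsAlt) (hn₄ : ω₄.Nondegenerate)
    (h : IsSimilarToElementOf f (lengthTwoStabilizer V₂ V₄ ω₄)) :
    ∃ (S : U ≃ₗ[ℂ] (Fin 2 → ℂ) × (Fin 4 → ℂ)) (m : Matrix (Fin 2) (Fin 2) ℂ)
      (β : Fin 2 → U → ℂ),
      (∀ x i, (S (f x)).1 i = m i 0 * (S x).1 0 + m i 1 * (S x).1 1) ∧
      ∀ x y, stdSymp₄ (S (f x)).2 (S y).2 + stdSymp₄ (S x).2 (S (f y)).2 =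
        -(m 0 0 + m 1 1) * stdSymp₄ (S x).2 (S y).2
        + ((S x).1 0 * β 0 y - (S y).1 0 * β 0 x)
        + ((S x).1 1 * β 1 y - (S y).1 1 * β 1 x) := by
  obtain ⟨T, f₂, k, f₄, hf₄, hf2, hf4⟩ := h
  rw [mem_skewAdjointLieSubalgebra_iff] at hf₄
  obtain ⟨T₄, hT₄⟩ := exists_symplectic_equiv hω₄ stdSymp₄_isAlt hn₄ stdSymp₄_nondegenerate
    (by rw [hV₄]; simp)
  let b : Basis (Fin 2) ℂ V₂ := finBasisOfFinrankEq ℂ V₂ hV₂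
  let P := (Submodule.prodEquivOfIsCompl V₂ V₄ hV).symm
  let S : U ≃ₗ[ℂ] (Fin 2 → ℂ) × (Fin 4 → ℂ) := T.trans (P.trans (b.equivFun.prodCongr T₄))
  set g := T.conj f with hg
  set t := LinearMap.trace ℂ V₂ f₂ with ht
  have hPg : ∀ v, P (g v) =
      (f₂ (P v).1, k (P v).1 + (-(t / 2)) • (P v).2 + f₄ (P v).2) := by
    intro v
    obtain ⟨⟨a, c⟩, rfl⟩ := P.symm.surjective v
    rw [P.apply_symm_apply, ← LinearEquiv.eq_symm_apply]
    simp only [P, LinearEquiv.symm_symm, Submodule.coe_prodEquivOfIsCompl', map_add, hf2, hf4,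
      Submodule.coe_add, Submodule.coe_smul]
    abel
  have hm : t = LinearMap.toMatrix b b f₂ 0 0 + LinearMap.toMatrix b b f₂ 1 1 := by
    rw [ht, LinearMap.trace_eq_matrix_trace ℂ b, Matrix.trace_fin_two]
  have hSf : ∀ x, S (f x) = (b.equivFun (f₂ (P (T x)).1),
      T₄ (k (P (T x)).1 + (-(t / 2)) • (P (T x)).2 + f₄ (P (T x)).2)) := by
    intro x
    have h1 : T (f x) = g (T x) := by simp [hg]
    have h2 : S (f x) = (b.equivFun.prodCongr T₄) (P (T (f x))) := rfl
    rw [h2, h1, hPg]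
    rfl
  have hS2 : ∀ x, (S x).2 = T₄ (P (T x)).2 := fun x => rfl
  have hS1 : ∀ x, (S x).1 = b.equivFun (P (T x)).1 := fun x => rfl
  have hk : ∀ x, k (P (T x)).1 = (S x).1 0 • k (b 0) + (S x).1 1 • k (b 1) := by
    intro x
    conv_lhs => rw [← b.sum_equivFun (P (T x)).1, Fin.sum_univ_two]
    rw [map_add, map_smul, map_smul, hS1]
  -- The covectors `β i` absorb the off-diagonal block `k`: it alters the form only by terms `aᵢ ∧
  -- βᵢ`, with `aᵢ` the coordinates on `V₂`.
  refine ⟨S, LinearMap.toMatrix b b f₂, fun i x => ω₄ (k (b i)) (P (T x)).2, ?_, ?_⟩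
  · intro x i
    rw [hSf, hS1]
    have := congrFun (LinearMap.toMatrix_mulVec_repr b b f₂ (P (T x)).1) i
    simpa [Matrix.mulVec, dotProduct, Fin.sum_univ_two] using this.symm
  · intro x y
    rw [hSf, hSf, hS2, hS2, ← hm]
    simp only [hT₄]
    have h1 := hf₄ (P (T x)).2 (P (T y)).2
    rw [hk, hk]
    have hneg : ∀ i, ω₄ (P (T x)).2 (k (b i)) = -ω₄ (k (b i)) (P (T x)).2 :=
      fun i => (hω₄.neg_eq _ _).symm
    simp only [map_add, map_smul, LinearMap.add_apply, LinearMap.smul_apply, smul_eq_mul, hneg]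
    linear_combination h1

end Symplectic

/-! ### Normal forms of the dual four-form on a hyperplane -/

section Constructions

variable {W : Type*} [AddCommGroup W] [Module ℂ W]

/-- The coordinates `(x₁, …, x₆, x₇)` on `ℂ⁶ × ℂ`. -/
def sixOneEquiv : ((Fin 6 → ℂ) × ℂ) ≃ₗ[ℂ] (Fin 7 → ℂ) where
  toFun p := ![p.1 0, p.1 1, p.1 2, p.1 3, p.1 4, p.1 5, p.2]
  map_add' p q := by ext i; fin_cases i <;> rfl
  map_smul' c p := by ext i; fin_cases i <;> rfl
  invFun q := (![q 0, q 1, q 2, q 3, q 4, q 5], q 6)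
  left_inv p := by
    ext i
    · fin_cases i <;> rfl
    · rfl
  right_inv q := by ext i; fin_cases i <;> rfl

/-- Coordinates on `(ℂ² × ℂ⁴) × ℂ` for which the last factor is conormal to a null hyperplane. -/
def nullEquiv : (((Fin 2 → ℂ) × (Fin 4 → ℂ)) × ℂ) ≃ₗ[ℂ] (Fin 7 → ℂ) where
  toFun p := ![-Complex.I * p.1.2 2, -Complex.I * p.2 + p.1.2 2, p.1.1 0 / 2 + p.1.2 0,
    -Complex.I * p.1.2 0 + Complex.I * p.1.1 0 / 2, p.1.1 1 / 2 + p.1.2 1,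
    -Complex.I * p.1.2 1 + Complex.I * p.1.1 1 / 2, p.1.2 3]
  map_add' p q := by ext i; fin_cases i <;> simp <;> ring
  map_smul' c p := by ext i; fin_cases i <;> simp <;> ring
  -- The last component `q 0 + I * q 1` has null coefficient vector `(1, I, 0, …, 0)`. On its kernel
  -- the `E⁷`-terms of `⋆φ` combine to a multiple of the wedge of the first two components, and the
  -- second pair makes `E^{3456}` such a multiple too.
  invFun q := ((![q 2 - Complex.I * q 3, q 4 - Complex.I * q 5],
    ![(q 2 + Complex.I * q 3) / 2, (q 4 + Complex.I * q 5) / 2, Complex.I * q 0, q 6]),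
    Complex.I * q 1 + q 0)
  left_inv p := by
    have h := Complex.I_mul_I
    ext i
    · fin_cases i <;> simp
      · linear_combination (p.1.2 0 - p.1.1 0 / 2) * h
      · linear_combination (p.1.2 1 - p.1.1 1 / 2) * h
    · fin_cases i <;> simp
      · linear_combination (-p.1.2 0 + p.1.1 0 / 2) / 2 * h
      · linear_combination (-p.1.2 1 + p.1.1 1 / 2) / 2 * h
      · linear_combination (-p.1.2 2) * h
    · simp
      linear_combination (-p.2) * h
  right_inv q := by
    have h := Complex.I_mul_I
    ext i
    fin_cases i <;> simp
    · linear_combination (-q 0) * h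
    · linear_combination (-q 1) * h
    · ring
    · linear_combination (-q 3) * h
    · ring
    · linear_combination (-q 5) * h

/-- On `x₇ = 0` only the three monomials without `E⁷` survive, and they sum to `½ ω ∧ ω`. -/
theorem psiForm_eq_of_coords_six (E : Basis (Fin 7) ℂ W) (c : W → Fin 6 → ℂ) {P : W → Prop}
    (h : ∀ x, P x → ∀ i, E.coord i x = sixOneEquiv (c x, 0) i) {x y z w : W}
    (hx : P x) (hy : P y) (hz : P z) (hw : P w) :
    psiForm E ![x, y, z, w] = stdSymp₆ (c x) (c y) * stdSymp₆ (c z) (c w)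
      - stdSymp₆ (c x) (c z) * stdSymp₆ (c y) (c w)
      + stdSymp₆ (c x) (c w) * stdSymp₆ (c y) (c z) := by
  simp only [psiForm_apply, basisForm_four_apply, h x hx, h y hy, h z hz, h w hw]
  simp [sixOneEquiv, stdSymp₆]
  ring

-- On the null hyperplane the monomials containing `E^{12}` vanish and the other five assemble to
-- `a₀ ∧ a₁ ∧ τ`, whose six shuffles are the terms on the right.
set_option maxRecDepth 100000 in
theorem psiForm_eq_of_coords_null (E : Basis (Fin 7) ℂ W) (c : W → (Fin 2 → ℂ) × (Fin 4 → ℂ))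
    {P : W → Prop} (h : ∀ x, P x → ∀ i, E.coord i x = nullEquiv (c x, 0) i) {x y z w : W}
    (hx : P x) (hy : P y) (hz : P z) (hw : P w) :
    psiForm E ![x, y, z, w] =
      ((c x).1 0 * (c y).1 1 - (c x).1 1 * (c y).1 0) * stdSymp₄ (c z).2 (c w).2
      - ((c x).1 0 * (c z).1 1 - (c x).1 1 * (c z).1 0) * stdSymp₄ (c y).2 (c w).2
      + ((c x).1 0 * (c w).1 1 - (c x).1 1 * (c w).1 0) * stdSymp₄ (c y).2 (c z).2
      + ((c y).1 0 * (c z).1 1 - (c y).1 1 * (c z).1 0) * stdSymp₄ (c x).2 (c w).2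
      - ((c y).1 0 * (c w).1 1 - (c y).1 1 * (c w).1 0) * stdSymp₄ (c x).2 (c z).2
      + ((c z).1 0 * (c w).1 1 - (c z).1 1 * (c w).1 0) * stdSymp₄ (c x).2 (c y).2 := by
  simp only [psiForm_apply, basisForm_four_apply, h x hx, h y hy, h z hz, h w hw]
  have h0 : ∀ p, nullEquiv (p, 0) 0 = -Complex.I * p.2 2 := fun _ => rfl
  have h1 : ∀ p, nullEquiv (p, 0) 1 = p.2 2 := fun p => by simp [nullEquiv]
  have h2 : ∀ p, nullEquiv (p, 0) 2 = p.1 0 / 2 + p.2 0 := fun _ => rfl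
  have h3 : ∀ p, nullEquiv (p, 0) 3 = -Complex.I * p.2 0 + Complex.I * p.1 0 / 2 := fun _ => rfl
  have h4 : ∀ p, nullEquiv (p, 0) 4 = p.1 1 / 2 + p.2 1 := fun _ => rfl
  have h5 : ∀ p, nullEquiv (p, 0) 5 = -Complex.I * p.2 1 + Complex.I * p.1 1 / 2 := fun _ => rfl
  have h6 : ∀ p, nullEquiv (p, 0) 6 = p.2 3 := fun _ => rfl
  have hs : ∀ u v, stdSymp₄ u v = u 0 * v 1 - u 1 * v 0 + (u 2 * v 3 - u 3 * v 2) :=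
    fun _ _ => rfl
  simp only [h0, h1, h2, h3, h4, h5, h6, hs]
  ring_nf
  simp only [Complex.I_sq]
  ring

end Constructions

section Constructions

variable {W : Type*} [AddCommGroup W] [Module ℂ W]

theorem formAction_eq_zero_of_square {Ψ : Form W 4} {F : End ℂ W} {P : W → Prop}
    (hP : ∀ x, P x → P (F x)) {ω : W → W → ℂ} (ha : ∀ x y, ω x y = -ω y x)
    (hΨ : ∀ x y z w, P x → P y → P z → P w →
      Ψ ![x, y, z, w] = ω x y * ω z w - ω x z * ω y w + ω x w * ω y z)
    (hω : ∀ x y, P x → P y → ω (F x) y + ω x (F y) = 0) {x y z w : W}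
    (hx : P x) (hy : P y) (hz : P z) (hw : P w) : formAction F Ψ x y z w = 0 := by
  rw [formAction, hΨ _ _ _ _ (hP x hx) hy hz hw, hΨ _ _ _ _ (hP y hy) hx hz hw,
    hΨ _ _ _ _ (hP z hz) hx hy hw, hΨ _ _ _ _ (hP w hw) hx hy hz,
    ha (F y) x, ha (F z) x, ha (F z) y, ha (F w) x, ha (F w) y, ha (F w) z]
  linear_combination ω z w * hω x y hx hy - ω y w * hω x z hx hz + ω y z * hω x w hx hw
    + ω x w * hω y z hy hz - ω x z * hω y w hy hw + ω x y * hω z w hz hw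

/-- `F` multiplies `a₀ ∧ a₁` by `tr m` and `τ` by `-tr m`, up to terms `aᵢ ∧ βᵢ` that `a₀ ∧ a₁`
kills. Linearity of `β` is never needed. -/
theorem formAction_eq_zero_of_product {Ψ : Form W 4} {F : End ℂ W} {P : W → Prop}
    (hP : ∀ x, P x → P (F x)) {τ : W → W → ℂ} {a β : Fin 2 → W → ℂ}
    {m : Matrix (Fin 2) (Fin 2) ℂ} (ha : ∀ x y, τ x y = -τ y x)
    (hΨ : ∀ x y z w, P x → P y → P z → P w → Ψ ![x, y, z, w] =
      (a 0 x * a 1 y - a 1 x * a 0 y) * τ z w - (a 0 x * a 1 z - a 1 x * a 0 z) * τ y w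
      + (a 0 x * a 1 w - a 1 x * a 0 w) * τ y z + (a 0 y * a 1 z - a 1 y * a 0 z) * τ x w
      - (a 0 y * a 1 w - a 1 y * a 0 w) * τ x z + (a 0 z * a 1 w - a 1 z * a 0 w) * τ x y)
    (hm : ∀ x, P x → ∀ i, a i (F x) = m i 0 * a 0 x + m i 1 * a 1 x)
    (hτ : ∀ x y, P x → P y → τ (F x) y + τ x (F y) = -(m 0 0 + m 1 1) * τ x y
      + (a 0 x * β 0 y - a 0 y * β 0 x) + (a 1 x * β 1 y - a 1 y * β 1 x)) {x y z w : W}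
    (hx : P x) (hy : P y) (hz : P z) (hw : P w) : formAction F Ψ x y z w = 0 := by
  rw [formAction, hΨ _ _ _ _ (hP x hx) hy hz hw, hΨ _ _ _ _ (hP y hy) hx hz hw,
    hΨ _ _ _ _ (hP z hz) hx hy hw, hΨ _ _ _ _ (hP w hw) hx hy hz,
    ha (F y) x, ha (F z) x, ha (F z) y, ha (F w) x, ha (F w) y, ha (F w) z]
  simp only [hm x hx, hm y hy, hm z hz, hm w hw]
  linear_combination (a 0 z * a 1 w - a 1 z * a 0 w) * hτ x y hx hy
    - (a 0 y * a 1 w - a 1 y * a 0 w) * hτ x z hx hz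
    + (a 0 y * a 1 z - a 1 y * a 0 z) * hτ x w hx hw
    + (a 0 x * a 1 w - a 1 x * a 0 w) * hτ y z hy hz
    - (a 0 x * a 1 z - a 1 x * a 0 z) * hτ y w hy hw
    + (a 0 x * a 1 y - a 1 x * a 0 y) * hτ z w hz hw

theorem stdSymp₆_neg (u v : Fin 6 → ℂ) : stdSymp₆ u v = -stdSymp₆ v u :=
  (stdSymp₆_isAlt.neg_eq v u).symm

theorem stdSymp₄_neg (u v : Fin 4 → ℂ) : stdSymp₄ u v = -stdSymp₄ v u :=
  (stdSymp₄_isAlt.neg_eq v u).symm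

theorem isNondegenerateSubspace_ker_coord [FiniteDimensional ℂ W] (E : Basis (Fin 7) ℂ W)
    {U : Submodule ℂ W} (hU : ∀ x, x ∈ U ↔ E.coord 6 x = 0) :
    IsNondegenerateSubspace (phiForm E) (volForm E) U := by
  have hl : ∀ x : U, (∀ y : U, orthoForm E x y = 0) → x = 0 := by
    intro x hx
    refine Subtype.ext (E.ext_elem fun i => ?_)
    by_cases hi : i = 6
    · subst hi
      simpa using (hU x).1 x.2
    · have hE : E i ∈ U := by
        rw [hU, coord_basis, if_neg (Ne.symm hi)]
      have := hx ⟨E i, hE⟩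
      rw [orthoForm_comm, orthoForm_basis_left] at this
      simpa using this
  refine ⟨orthoForm E, isInducedForm_orthoForm E, hl, fun x hx => hl x fun y => ?_⟩
  rw [orthoForm_comm]
  exact hx y

/-- The decomposition of a vector space into a hyperplane `ker α` and a line spanned by `e`. -/
def hyperplaneEquiv {U : Submodule ℂ W} (α : Dual ℂ W) (hU : ∀ x, x ∈ U ↔ α x = 0) (e : W)
    (he : α e = 1) : W ≃ₗ[ℂ] U × ℂ where
  toFun x := (⟨x - α x • e, by rw [hU]; simp [he]⟩, α x)
  map_add' x y := by
    ext
    · simp; module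
    · simp
  map_smul' c x := by
    ext
    · simp; module
    · simp
  invFun p := p.1 + p.2 • e
  left_inv x := by simp
  right_inv p := by
    have h := (hU p.1).1 p.1.2
    ext
    · simp [h, he]
    · simp [h, he]

theorem hyperplaneEquiv_of_mem {U : Submodule ℂ W} (α : Dual ℂ W) (hU : ∀ x, x ∈ U ↔ α x = 0)
    (e : W) (he : α e = 1) (x : U) : hyperplaneEquiv α hU e he x = (x, 0) := by
  have h := (hU x).1 x.2
  ext
  · simp [hyperplaneEquiv, h]
  · simp [hyperplaneEquiv, h]

end Constructions

theorem ad_coe_ideal {𝔤 : Type*} [LieRing 𝔤] [LieAlgebra ℂ 𝔤] (𝔲 : LieIdeal ℂ 𝔤)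
    (e₇ : 𝔤) (u : 𝔲) :
    LieAlgebra.ad ℂ 𝔤 e₇ u = LieModule.toEnd ℂ 𝔤 𝔲 e₇ u := rfl

/-! ### Constructing cocalibrated structures -/

section LieAlgebra

variable {𝔤 : Type*} [LieRing 𝔤] [LieAlgebra ℂ 𝔤] [FiniteDimensional ℂ 𝔤]

/-- The vectors `x - α x • e₇` and `y - α y • e₇` lie in the Abelian ideal; expanding their
vanishing bracket gives the formula. -/
theorem exists_conormal (h𝔤 : finrank ℂ 𝔤 = 7) (𝔲 : LieIdeal ℂ 𝔤) (h𝔲 : finrank ℂ 𝔲 = 6)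
    (habel : IsLieAbelian 𝔲) (e₇ : 𝔤) (he₇ : e₇ ∉ 𝔲) :
    ∃ α : Dual ℂ 𝔤, α e₇ = 1 ∧ (∀ x, x ∈ 𝔲.toSubmodule ↔ α x = 0) ∧
      ∀ x y : 𝔤, ⁅x, y⁆ = α x • LieAlgebra.ad ℂ 𝔤 e₇ y - α y • LieAlgebra.ad ℂ 𝔤 e₇ x := by
  obtain ⟨f, hf, hle⟩ := Submodule.exists_le_ker_of_notMem (p := 𝔲.toSubmodule) (v := e₇) he₇
  set α : Dual ℂ 𝔤 := (f e₇)⁻¹ • f with hα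
  have he : α e₇ = 1 := by simp [hα, hf]
  have hle' : 𝔲.toSubmodule ≤ LinearMap.ker α := by
    intro x hx
    have := hle hx
    rw [LinearMap.mem_ker] at this ⊢
    simp [hα, this]
  have hker : 𝔲.toSubmodule = LinearMap.ker α := by
    refine Submodule.eq_of_le_of_finrank_eq hle' ?_
    have h1 := LinearMap.finrank_range_add_finrank_ker α
    have h2 : LinearMap.range α = ⊤ := by
      rw [LinearMap.range_eq_top]
      intro c
      exact ⟨c • e₇, by simp [he]⟩
    rw [h2, finrank_top, Module.finrank_self, h𝔤] at h1
    have h3 : finrank ℂ 𝔲.toSubmodule = 6 := h𝔲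
    omega
  have hmem : ∀ x, x ∈ 𝔲.toSubmodule ↔ α x = 0 := by
    intro x
    rw [hker, LinearMap.mem_ker]
  refine ⟨α, he, hmem, fun x y => ?_⟩
  have hx : x - α x • e₇ ∈ 𝔲 := (hmem _).2 (by simp [he])
  have hy : y - α y • e₇ ∈ 𝔲 := (hmem _).2 (by simp [he])
  have h0 : ⁅x - α x • e₇, y - α y • e₇⁆ = 0 := by
    have := habel.trivial ⟨_, hx⟩ ⟨_, hy⟩
    exact congrArg Subtype.val this
  simp only [sub_lie, lie_sub, smul_lie, lie_smul, lie_self, smul_zero, sub_zero] at h0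
  have hsk : ⁅x, e₇⁆ = -⁅e₇, x⁆ := (lie_skew x e₇).symm
  rw [hsk] at h0
  rw [LieAlgebra.ad_apply, LieAlgebra.ad_apply, ← sub_eq_zero, ← h0]
  module

theorem exists_cocalibrated_of_skewAdjoint (h𝔤 : finrank ℂ 𝔤 = 7) (𝔲 : LieIdeal ℂ 𝔤)
    (h𝔲 : finrank ℂ 𝔲 = 6) (habel : IsLieAbelian 𝔲) (e₇ : 𝔤) (he₇ : e₇ ∉ 𝔲)
    {ω₆ : LinearMap.BilinForm ℂ 𝔲} (hω₆ : ω₆.IsAlt) (hn₆ : ω₆.Nondegenerate)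
    (h : IsSimilarToElementOf (LieModule.toEnd ℂ 𝔤 𝔲 e₇) (skewAdjointLieSubalgebra ω₆)) :
    ∃ (φ : Form 𝔤 3) (vol : Form 𝔤 7), IsCocalibratedG2Structure φ vol ∧
      IsNondegenerateSubspace φ vol 𝔲.toSubmodule := by
  obtain ⟨α, he, hmem, hbr⟩ := exists_conormal h𝔤 𝔲 h𝔲 habel e₇ he₇
  obtain ⟨T, hT⟩ := exists_coordinates_of_skewAdjoint h𝔲 hω₆ hn₆ h
  let H := hyperplaneEquiv (U := 𝔲.toSubmodule) α hmem e₇ he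
  let E : Basis (Fin 7) ℂ 𝔤 := Basis.ofEquivFun
    (H.trans ((LinearEquiv.prodCongr T (LinearEquiv.refl ℂ ℂ)).trans sixOneEquiv))
  have hE : ∀ x i, E.coord i x = sixOneEquiv (T (H x).1, α x) i := fun x i => by
    simp [E, H, hyperplaneEquiv]
  have hH : ∀ x : 𝔲, (H x).1 = x := fun x =>
    congrArg Prod.fst (hyperplaneEquiv_of_mem (U := 𝔲.toSubmodule) α hmem e₇ he x)
  have hP : ∀ x, x ∈ 𝔲 → LieAlgebra.ad ℂ 𝔤 e₇ x ∈ 𝔲 := fun x hx => lie_mem_right _ _ _ _ _ hx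
  refine ⟨phiForm E, volForm E, (isCocalibratedG2Structure_iff _ _).2 ⟨E, rfl, rfl, ?_⟩,
    isNondegenerateSubspace_ker_coord E fun x => ?_⟩
  · refine lieExtDeriv_eq_zero_of_ker he hbr fun x y z w hx hy hz hw => ?_
    refine formAction_eq_zero_of_square (P := fun x => x ∈ 𝔲) hP
      (ω := fun x y => stdSymp₆ (T (H x).1) (T (H y).1)) (fun _ _ => stdSymp₆_neg _ _) ?_ ?_
      ((hmem x).2 hx) ((hmem y).2 hy) ((hmem z).2 hz) ((hmem w).2 hw)
    · intro x y z w hx hy hz hw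
      refine psiForm_eq_of_coords_six E (fun x => T (H x).1) (P := fun x => x ∈ 𝔲)
        (fun x hx i => ?_) hx hy hz hw
      rw [hE, (hmem x).1 hx]
    · intro x y hx hy
      lift x to 𝔲 using hx
      lift y to 𝔲 using hy
      simp only [ad_coe_ideal, hH]
      exact hT x y
  · rw [hE, hmem]
    rfl

/-- The basis `E` is chosen so that `α` becomes the null covector of `nullEquiv` and the coordinates
on `𝔲` are those adapted to the stabilizer. -/
theorem exists_cocalibrated_of_lengthTwoStabilizer (h𝔤 : finrank ℂ 𝔤 = 7) (𝔲 : LieIdeal ℂ 𝔤)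
    (h𝔲 : finrank ℂ 𝔲 = 6) (habel : IsLieAbelian 𝔲) (e₇ : 𝔤) (he₇ : e₇ ∉ 𝔲)
    {V₂ V₄ : Submodule ℂ 𝔲} (hV₂ : finrank ℂ V₂ = 2) (hV₄ : finrank ℂ V₄ = 4)
    (hV : IsCompl V₂ V₄) {ω₄ : LinearMap.BilinForm ℂ V₄} (hω₄ : ω₄.IsAlt)
    (hn₄ : ω₄.Nondegenerate)
    (h : IsSimilarToElementOf (LieModule.toEnd ℂ 𝔤 𝔲 e₇) (lengthTwoStabilizer V₂ V₄ ω₄)) :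
    ∃ (φ : Form 𝔤 3) (vol : Form 𝔤 7), IsCocalibratedG2Structure φ vol := by
  obtain ⟨α, he, hmem, hbr⟩ := exists_conormal h𝔤 𝔲 h𝔲 habel e₇ he₇
  obtain ⟨S, m, β, hm, hS⟩ := exists_coordinates_of_lengthTwoStabilizer hV₂ hV₄ hV hω₄ hn₄ h
  let H := hyperplaneEquiv (U := 𝔲.toSubmodule) α hmem e₇ he
  let E : Basis (Fin 7) ℂ 𝔤 := Basis.ofEquivFun
    (H.trans ((LinearEquiv.prodCongr S (LinearEquiv.refl ℂ ℂ)).trans nullEquiv))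
  have hE : ∀ x i, E.coord i x = nullEquiv (S (H x).1, α x) i := fun x i => by
    simp [E, H, hyperplaneEquiv]
  have hH : ∀ x : 𝔲, (H x).1 = x := fun x =>
    congrArg Prod.fst (hyperplaneEquiv_of_mem (U := 𝔲.toSubmodule) α hmem e₇ he x)
  have hP : ∀ x, x ∈ 𝔲 → LieAlgebra.ad ℂ 𝔤 e₇ x ∈ 𝔲 := fun x hx => lie_mem_right _ _ _ _ _ hx
  refine ⟨phiForm E, volForm E, (isCocalibratedG2Structure_iff _ _).2 ⟨E, rfl, rfl, ?_⟩⟩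
  refine lieExtDeriv_eq_zero_of_ker he hbr fun x y z w hx hy hz hw => ?_
  refine formAction_eq_zero_of_product (P := fun x => x ∈ 𝔲) hP
    (τ := fun x y => stdSymp₄ (S (H x).1).2 (S (H y).1).2)
    (a := fun i x => (S (H x).1).1 i) (β := fun i x => β i (H x).1) (m := m)
    (fun _ _ => stdSymp₄_neg _ _) ?_ ?_ ?_
    ((hmem x).2 hx) ((hmem y).2 hy) ((hmem z).2 hz) ((hmem w).2 hw)
  · intro x y z w hx hy hz hw
    refine psiForm_eq_of_coords_null E (fun x => S (H x).1) (P := fun x => x ∈ 𝔲)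
      (fun x hx i => ?_) hx hy hz hw
    rw [hE, (hmem x).1 hx]
  · intro x hx i
    lift x to 𝔲 using hx
    simp only [ad_coe_ideal, hH]
    exact hm x i
  · intro x y hx hy
    lift x to 𝔲 using hx
    lift y to 𝔲 using hy
    simp only [ad_coe_ideal, hH]
    exact hS x y

end LieAlgebra

/-! ### Closedness as invariance of the cross product matrix -/

section CrossProduct

/-- The matrix of the cross product by `n`. -/
def crossMatrix (n : Fin 7 → ℂ) : Matrix (Fin 7) (Fin 7) ℂ :=
  !![0, n 6, n 4, -n 5, -n 2, n 3, -n 1;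
    -n 6, 0, -n 5, -n 4, n 3, n 2, n 0;
    -n 4, n 5, 0, n 6, n 0, -n 1, -n 3;
    n 5, n 4, -n 6, 0, -n 1, -n 0, n 2;
    n 2, -n 3, -n 0, n 1, 0, n 6, -n 5;
    -n 3, -n 2, n 1, n 0, -n 6, 0, n 4;
    n 1, -n 0, n 3, -n 2, n 5, -n 4, 0]

/-- A table for evaluating `formAction` on basis vectors, where the image under `F` always sits in
the first slot. -/
theorem psiForm_contract {W : Type*} [AddCommGroup W] [Module ℂ W] (E : Basis (Fin 7) ℂ W)
    (v : W) :
    psiForm E ![v, E 0, E 1, E 2] = -E.coord 3 v ∧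
    psiForm E ![v, E 0, E 1, E 3] = E.coord 2 v ∧
    psiForm E ![v, E 0, E 1, E 4] = -E.coord 5 v ∧
    psiForm E ![v, E 0, E 1, E 5] = E.coord 4 v ∧
    psiForm E ![v, E 0, E 1, E 6] = 0 ∧
    psiForm E ![v, E 0, E 2, E 3] = -E.coord 1 v ∧
    psiForm E ![v, E 0, E 2, E 4] = 0 ∧
    psiForm E ![v, E 0, E 2, E 5] = -E.coord 6 v ∧
    psiForm E ![v, E 0, E 2, E 6] = E.coord 5 v ∧
    psiForm E ![v, E 0, E 3, E 4] = -E.coord 6 v ∧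
    psiForm E ![v, E 0, E 3, E 5] = 0 ∧
    psiForm E ![v, E 0, E 3, E 6] = E.coord 4 v ∧
    psiForm E ![v, E 0, E 4, E 5] = -E.coord 1 v ∧
    psiForm E ![v, E 0, E 4, E 6] = -E.coord 3 v ∧
    psiForm E ![v, E 0, E 5, E 6] = -E.coord 2 v ∧
    psiForm E ![v, E 1, E 2, E 3] = E.coord 0 v ∧
    psiForm E ![v, E 1, E 2, E 4] = -E.coord 6 v ∧
    psiForm E ![v, E 1, E 2, E 5] = 0 ∧
    psiForm E ![v, E 1, E 2, E 6] = E.coord 4 v ∧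
    psiForm E ![v, E 1, E 3, E 4] = 0 ∧
    psiForm E ![v, E 1, E 3, E 5] = E.coord 6 v ∧
    psiForm E ![v, E 1, E 3, E 6] = -E.coord 5 v ∧
    psiForm E ![v, E 1, E 4, E 5] = E.coord 0 v ∧
    psiForm E ![v, E 1, E 4, E 6] = -E.coord 2 v ∧
    psiForm E ![v, E 1, E 5, E 6] = E.coord 3 v ∧
    psiForm E ![v, E 2, E 3, E 4] = -E.coord 5 v ∧
    psiForm E ![v, E 2, E 3, E 5] = E.coord 4 v ∧
    psiForm E ![v, E 2, E 3, E 6] = 0 ∧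
    psiForm E ![v, E 2, E 4, E 5] = -E.coord 3 v ∧
    psiForm E ![v, E 2, E 4, E 6] = E.coord 1 v ∧
    psiForm E ![v, E 2, E 5, E 6] = E.coord 0 v ∧
    psiForm E ![v, E 3, E 4, E 5] = E.coord 2 v ∧
    psiForm E ![v, E 3, E 4, E 6] = E.coord 0 v ∧
    psiForm E ![v, E 3, E 5, E 6] = -E.coord 1 v ∧
    psiForm E ![v, E 4, E 5, E 6] = 0 := by
  simp only [psiForm_apply, basisForm_four_apply, coord_basis, Fin.reduceEq, if_true, if_false]
  ring_nf
  simp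

variable {𝔤 : Type*} [LieRing 𝔤] [LieAlgebra ℂ 𝔤]

theorem crossMatrix_relation_aux {E : Basis (Fin 7) ℂ 𝔤} {α : Dual ℂ 𝔤} {F : End ℂ 𝔤}
    (hbr : ∀ x y : 𝔤, ⁅x, y⁆ = α x • F y - α y • F x) (hα : ∀ x, α (F x) = 0)
    (hd : lieExtDeriv (psiForm E) = 0) {n : Fin 7 → ℂ} (hn : n = fun i => α (E i))
    {f : Matrix (Fin 7) (Fin 7) ℂ} (hf : f = Matrix.of fun i j => E.coord i (F (E j)))
    {a b : Fin 7} (hab : a < b) :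
    (f * crossMatrix n + crossMatrix n * f.transpose - f.trace • crossMatrix n) a b = 0 := by
  have hF : ∀ i j, E.coord i (F (E j)) = f i j := fun i j => by rw [hf]; rfl
  have hE : ∀ i, α (E i) = n i := fun i => by rw [hn]
  -- The relation `nᵀ f = 0`, that is, `α ∘ F = 0` in coordinates.
  have hk : ∀ k, n 0 * f 0 k + n 1 * f 1 k + n 2 * f 2 k + n 3 * f 3 k + n 4 * f 4 k
      + n 5 * f 5 k + n 6 * f 6 k = 0 := by
    intro k
    have h := hα (E k)
    rw [← E.sum_repr (F (E k)), map_sum, Fin.sum_univ_seven] at h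
    simp only [map_smul, smul_eq_mul, hE, ← Basis.coord_apply, hF] at h
    linear_combination h
  have hG : ∀ i j k l m : Fin 7, _ := fun i j k l m =>
    (lieExtDeriv_eq α F hbr (psiForm E) ![E i, E j, E k, E l, E m]).symm.trans
      (congrFun hd _)
  have hD : ∀ a b, (f * crossMatrix n + crossMatrix n * f.transpose
      - f.trace • crossMatrix n) a b =
      (∑ k, f a k * crossMatrix n k b) + (∑ k, crossMatrix n a k * f b k)
        - (∑ k, f k k) * crossMatrix n a b := fun a b => by
    simp [Matrix.mul_apply, Matrix.trace]
  rw [hD]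
  simp only [Fin.sum_univ_seven]
  simp only [formAction, hE, Matrix.cons_val, Pi.zero_apply] at hG
  -- The `(a, b)` entry is, up to sign, the closedness equation on the five complementary basis
  -- vectors, corrected by `± hk c`, where `± n c` is the `(a, b)` entry of `crossMatrix n`.
  fin_cases a <;> fin_cases b <;> first | exact absurd hab (by decide) | skip
  · have h := hG 2 3 4 5 6
    simp only [psiForm_contract, hF] at h
    simp [crossMatrix]
    linear_combination h - hk 6
  · have h := hG 1 3 4 5 6
    simp only [psiForm_contract, hF] at h
    simp [crossMatrix]
    linear_combination -h - hk 4
  · have h := hG 1 2 4 5 6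
    simp only [psiForm_contract, hF] at h
    simp [crossMatrix]
    linear_combination h + hk 5
  · have h := hG 1 2 3 5 6
    simp only [psiForm_contract, hF] at h
    simp [crossMatrix]
    linear_combination -h + hk 2
  · have h := hG 1 2 3 4 6
    simp only [psiForm_contract, hF] at h
    simp [crossMatrix]
    linear_combination h - hk 3
  · have h := hG 1 2 3 4 5
    simp only [psiForm_contract, hF] at h
    simp [crossMatrix]
    linear_combination -h + hk 1
  · have h := hG 0 3 4 5 6
    simp only [psiForm_contract, hF] at h
    simp [crossMatrix]
    linear_combination h + hk 5
  · have h := hG 0 2 4 5 6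
    simp only [psiForm_contract, hF] at h
    simp [crossMatrix]
    linear_combination -h + hk 4
  · have h := hG 0 2 3 5 6
    simp only [psiForm_contract, hF] at h
    simp [crossMatrix]
    linear_combination h - hk 3
  · have h := hG 0 2 3 4 6
    simp only [psiForm_contract, hF] at h
    simp [crossMatrix]
    linear_combination -h - hk 2
  · have h := hG 0 2 3 4 5
    simp only [psiForm_contract, hF] at h
    simp [crossMatrix]
    linear_combination h - hk 0
  · have h := hG 0 1 4 5 6
    simp only [psiForm_contract, hF] at h
    simp [crossMatrix]
    linear_combination h - hk 6
  · have h := hG 0 1 3 5 6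
    simp only [psiForm_contract, hF] at h
    simp [crossMatrix]
    linear_combination -h - hk 0
  · have h := hG 0 1 3 4 6
    simp only [psiForm_contract, hF] at h
    simp [crossMatrix]
    linear_combination h + hk 1
  · have h := hG 0 1 3 4 5
    simp only [psiForm_contract, hF] at h
    simp [crossMatrix]
    linear_combination -h + hk 3
  · have h := hG 0 1 2 5 6
    simp only [psiForm_contract, hF] at h
    simp [crossMatrix]
    linear_combination h + hk 1
  · have h := hG 0 1 2 4 6
    simp only [psiForm_contract, hF] at h
    simp [crossMatrix]
    linear_combination -h + hk 0
  · have h := hG 0 1 2 4 5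
    simp only [psiForm_contract, hF] at h
    simp [crossMatrix]
    linear_combination h - hk 2
  · have h := hG 0 1 2 3 6
    simp only [psiForm_contract, hF] at h
    simp [crossMatrix]
    linear_combination h - hk 6
  · have h := hG 0 1 2 3 5
    simp only [psiForm_contract, hF] at h
    simp [crossMatrix]
    linear_combination -h + hk 5
  · have h := hG 0 1 2 3 4
    simp only [psiForm_contract, hF] at h
    simp [crossMatrix]
    linear_combination h - hk 4

theorem crossMatrix_transpose (n : Fin 7 → ℂ) : (crossMatrix n)ᵀ = -crossMatrix n := by
  ext i j
  fin_cases i <;> fin_cases j <;> simp [crossMatrix]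

/-- The double cross product identity. It inverts the matrix on `n⊥` when `n·n ≠ 0`, and makes its
square of rank at most one when `n·n = 0`. -/
theorem crossMatrix_mulVec_mulVec (n y : Fin 7 → ℂ) :
    crossMatrix n *ᵥ (crossMatrix n *ᵥ y) = -(n ⬝ᵥ n) • y + (n ⬝ᵥ y) • n := by
  ext i
  fin_cases i <;> simp [crossMatrix, Matrix.mulVec, dotProduct, Fin.sum_univ_seven] <;> ring

theorem dotProduct_crossMatrix_mulVec (n y : Fin 7 → ℂ) : n ⬝ᵥ (crossMatrix n *ᵥ y) = 0 := by
  simp [crossMatrix, Matrix.mulVec, dotProduct, Fin.sum_univ_seven]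
  ring

/-- The defect is antisymmetric, so its entries above the diagonal suffice. -/
theorem crossMatrix_relation {E : Basis (Fin 7) ℂ 𝔤} {α : Dual ℂ 𝔤} {F : End ℂ 𝔤}
    (hbr : ∀ x y : 𝔤, ⁅x, y⁆ = α x • F y - α y • F x) (hα : ∀ x, α (F x) = 0)
    (hd : lieExtDeriv (psiForm E) = 0) {n : Fin 7 → ℂ} (hn : n = fun i => α (E i))
    {f : Matrix (Fin 7) (Fin 7) ℂ} (hf : f = Matrix.of fun i j => E.coord i (F (E j))) :
    f * crossMatrix n + crossMatrix n * fᵀ = f.trace • crossMatrix n := by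
  rw [← sub_eq_zero]
  set D := f * crossMatrix n + crossMatrix n * fᵀ - f.trace • crossMatrix n with hD
  have hs : Dᵀ = -D := by
    rw [hD]
    simp only [Matrix.transpose_sub, Matrix.transpose_add, Matrix.transpose_mul,
      Matrix.transpose_smul, crossMatrix_transpose, Matrix.transpose_transpose, Matrix.neg_mul,
      Matrix.mul_neg, smul_neg]
    abel
  have hs' : ∀ a b, D b a = -D a b := fun a b => congrFun (congrFun hs a) b
  ext a b
  rcases lt_trichotomy a b with h | rfl | h
  · exact crossMatrix_relation_aux hbr hα hd hn hf h
  · exact self_eq_neg.1 (hs' a a)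
  · rw [hs', Matrix.zero_apply, neg_eq_zero]
    exact crossMatrix_relation_aux hbr hα hd hn hf h

theorem four_le_rank_of_minor {n : Fin 7 → ℂ} (q : Fin 4 → Fin 7) {c : ℂ} (hc : c ≠ 0)
    (h : ((crossMatrix n).submatrix q q).det = c ^ 2) : 4 ≤ (crossMatrix n).rank := by
  have h1 := Matrix.rank_submatrix_le (crossMatrix n) q q
  rwa [Matrix.rank_of_isUnit _ ((Matrix.isUnit_iff_isUnit_det _).2
    (h ▸ (pow_ne_zero 2 hc).isUnit)), Fintype.card_fin] at h1

theorem det_skew_four (a b c d e f : ℂ) :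
    (!![0, a, b, c; -a, 0, d, e; -b, -d, 0, f; -c, -e, -f, 0] : Matrix (Fin 4) (Fin 4) ℂ).det =
      (a * f - b * e + c * d) ^ 2 := by
  rw [Matrix.det_succ_row_zero]
  simp [Matrix.det_fin_three, Fin.sum_univ_four, Fin.succAbove]
  ring

theorem det_submatrix_crossMatrix (n : Fin 7 → ℂ) (i j k l : Fin 7) :
    ((crossMatrix n).submatrix ![i, j, k, l] ![i, j, k, l]).det =
      (crossMatrix n i j * crossMatrix n k l - crossMatrix n i k * crossMatrix n j l
        + crossMatrix n i l * crossMatrix n j k) ^ 2 := by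
  have hs : ∀ a b, crossMatrix n b a = -crossMatrix n a b := fun a b =>
    congrFun (congrFun (crossMatrix_transpose n) a) b
  have h0 : ∀ a, crossMatrix n a a = 0 := fun a => self_eq_neg.1 (hs a a)
  rw [← det_skew_four]
  congr 1
  ext a b
  fin_cases a <;> fin_cases b <;>
    first | exact h0 _ | exact hs _ _ | rfl

/-- Below rank four all principal `4 × 4` Pfaffians vanish. On the index sets of the monomials of
`⋆φ` they are, up to sign, sums of three squares along the lines of the Fano plane. Each index lies
on three lines and any two share one, so the three sums through `i` add up to `2 nᵢ² + n·n`. -/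
theorem four_le_rank_crossMatrix {n : Fin 7 → ℂ} (hn : n ≠ 0) (h0 : n ⬝ᵥ n = 0) :
    4 ≤ (crossMatrix n).rank := by
  by_contra hr
  have h : ∀ (i j k l : Fin 7) (c : ℂ),
      crossMatrix n i j * crossMatrix n k l - crossMatrix n i k * crossMatrix n j l
        + crossMatrix n i l * crossMatrix n j k = c → c = 0 := by
    intro i j k l c hc
    by_contra hc0
    exact hr (four_le_rank_of_minor ![i, j, k, l] hc0 (by rw [det_submatrix_crossMatrix, hc]))
  have h1 := h 2 3 4 5 (n 0 ^ 2 + n 1 ^ 2 + n 6 ^ 2) (by simp [crossMatrix]; ring)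
  have h2 := h 0 1 4 5 (n 2 ^ 2 + n 3 ^ 2 + n 6 ^ 2) (by simp [crossMatrix]; ring)
  have h3 := h 0 1 2 3 (n 4 ^ 2 + n 5 ^ 2 + n 6 ^ 2) (by simp [crossMatrix]; ring)
  have h4 := h 1 3 5 6 (-(n 0 ^ 2 + n 2 ^ 2 + n 4 ^ 2)) (by simp [crossMatrix]; ring)
  have h5 := h 1 2 4 6 (n 0 ^ 2 + n 3 ^ 2 + n 5 ^ 2) (by simp [crossMatrix]; ring)
  have h6 := h 0 3 4 6 (n 1 ^ 2 + n 2 ^ 2 + n 5 ^ 2) (by simp [crossMatrix]; ring)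
  have h7 := h 0 2 5 6 (n 1 ^ 2 + n 3 ^ 2 + n 4 ^ 2) (by simp [crossMatrix]; ring)
  simp only [dotProduct, Fin.sum_univ_seven] at h0
  apply hn
  ext i
  refine pow_eq_zero_iff two_ne_zero |>.1 ?_
  fin_cases i
  · change n 0 ^ 2 = 0
    linear_combination (h1 - h4 + h5 - h0) / 2
  · change n 1 ^ 2 = 0
    linear_combination (h1 + h6 + h7 - h0) / 2
  · change n 2 ^ 2 = 0
    linear_combination (h2 - h4 + h6 - h0) / 2
  · change n 3 ^ 2 = 0
    linear_combination (h2 + h5 + h7 - h0) / 2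
  · change n 4 ^ 2 = 0
    linear_combination (h3 - h4 + h7 - h0) / 2
  · change n 5 ^ 2 = 0
    linear_combination (h3 + h5 + h6 - h0) / 2
  · change n 6 ^ 2 = 0
    linear_combination (h1 + h2 + h3 - h0) / 2

/-- The square of the matrix has range in the line of `n`, so the rank is at most `1 + dim ker`,
that is `1 + (7 - rank)`. -/
theorem rank_crossMatrix_le_four {n : Fin 7 → ℂ} (h0 : n ⬝ᵥ n = 0) :
    (crossMatrix n).rank ≤ 4 := by
  set M := (crossMatrix n).mulVecLin with hM
  have h1 := LinearMap.finrank_range_add_finrank_ker M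
  have h2 := LinearMap.finrank_range_add_finrank_ker (M.domRestrict (LinearMap.range M))
  have h3 : LinearMap.range (M.domRestrict (LinearMap.range M)) ≤ Submodule.span ℂ {n} := by
    rintro _ ⟨⟨_, y, rfl⟩, rfl⟩
    rw [Submodule.mem_span_singleton]
    refine ⟨n ⬝ᵥ y, ?_⟩
    have := crossMatrix_mulVec_mulVec n y
    rw [h0, neg_zero, zero_smul, zero_add] at this
    exact this.symm
  have h4 := (Submodule.finrank_mono h3).trans (finrank_span_le_card {n})
  have h5 : finrank ℂ (LinearMap.ker (M.domRestrict (LinearMap.range M))) ≤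
      finrank ℂ (LinearMap.ker M) := by
    have hm : ∀ x : LinearMap.ker (M.domRestrict (LinearMap.range M)), M x.1 = 0 := fun x => x.2
    refine LinearMap.finrank_le_finrank_of_injective (f := ((LinearMap.range M).subtype ∘ₗ
      (LinearMap.ker (M.domRestrict (LinearMap.range M))).subtype).codRestrict
        (LinearMap.ker M) hm) fun x y hxy => ?_
    have hxy' := congrArg (Subtype.val : LinearMap.ker M → (Fin 7 → ℂ)) hxy
    exact Subtype.ext (Subtype.ext hxy')
  rw [Module.finrank_fin_fun] at h1
  rw [Set.toFinset_singleton, Finset.card_singleton] at h4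
  change finrank ℂ (LinearMap.range M) ≤ 4
  omega

end CrossProduct

/-! ### The symplectic form on the range of a bivector -/

section Bivector

/-- The antisymmetric `N` induces `τ(N y, N z) = y · N z` on its range, well defined and
non-degenerate because `N` is antisymmetric. The relation turns `f N y` into `N (t y - fᵀ y)`, which
yields both invariance of the range and the factor `t`. -/
theorem exists_conformal_form {ι U : Type*} [Fintype ι] [DecidableEq ι] [AddCommGroup U]
    [Module ℂ U] {c : U →ₗ[ℂ] (ι → ℂ)} (hc : Function.Injective c) {f N : Matrix ι ι ℂ}
    {g : End ℂ U} {t : ℂ} (hg : ∀ u, c (g u) = f *ᵥ c u) (hN : Nᵀ = -N)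
    (hrel : f * N + N * fᵀ = t • N) (hrange : ∀ y, ∃ u, c u = N *ᵥ y) :
    ∃ (S : Submodule ℂ U) (τ : LinearMap.BilinForm ℂ S) (gS : End ℂ S),
      τ.IsAlt ∧ τ.Nondegenerate ∧ (∀ x : S, g x = gS x) ∧
      (∀ x y, τ (gS x) y + τ x (gS y) = t * τ x y) ∧
      (∀ u, u ∈ S ↔ ∃ y, c u = N *ᵥ y) ∧ finrank ℂ S = N.rank := by
  let S : Submodule ℂ U := (LinearMap.range N.mulVecLin).comap c
  have hS : ∀ u, u ∈ S ↔ ∃ y, c u = N *ᵥ y := fun u =>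
    ⟨fun ⟨y, hy⟩ => ⟨y, hy.symm⟩, fun ⟨y, hy⟩ => ⟨y, hy.symm⟩⟩
  have hskew : ∀ y z, y ⬝ᵥ N *ᵥ z = -(z ⬝ᵥ N *ᵥ y) := by
    intro y z
    rw [Matrix.dotProduct_mulVec, ← Matrix.mulVec_transpose, hN, Matrix.neg_mulVec, neg_dotProduct,
      dotProduct_comm]
  have hex : ∀ s : S, ∃ y, c s = N *ᵥ y := fun s => (hS s).1 s.2
  choose r hr using hex
  -- The pairing does not depend on the chosen preimage; bilinearity of `τ` rests on this.
  have hpair : ∀ (s s' : S) (y : ι → ℂ), c s = N *ᵥ y → r s ⬝ᵥ c s' = y ⬝ᵥ c s' := by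
    intro s s' y hy
    rw [hr s', hskew, ← hr s, hy, hskew, neg_neg]
  let τ : LinearMap.BilinForm ℂ S := LinearMap.mk₂ ℂ (fun s s' => r s ⬝ᵥ c s')
    (fun s₁ s₂ s' => by
      rw [hpair (s₁ + s₂) s' (r s₁ + r s₂), add_dotProduct]
      rw [Matrix.mulVec_add, ← hr, ← hr, Submodule.coe_add, map_add])
    (fun a s s' => by
      rw [hpair (a • s) s' (a • r s), smul_dotProduct]
      rw [Matrix.mulVec_smul, ← hr, Submodule.coe_smul, map_smul])
    (fun s s₁ s₂ => by rw [Submodule.coe_add, map_add, dotProduct_add])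
    (fun a s s' => by rw [Submodule.coe_smul, map_smul, dotProduct_smul])
  have hτ : ∀ (s s' : S) (y : ι → ℂ), c s = N *ᵥ y → τ s s' = y ⬝ᵥ c s' := hpair
  have hgN : ∀ (s : S), c (g s) = N *ᵥ (t • r s - fᵀ *ᵥ r s) := by
    intro s
    rw [hg, hr, Matrix.mulVec_mulVec, eq_sub_of_add_eq hrel, Matrix.mulVec_sub,
      Matrix.sub_mulVec, Matrix.smul_mulVec, Matrix.mulVec_smul, Matrix.mulVec_mulVec]
  let gS : End ℂ S := g.restrict fun u hu => (hS _).2 ⟨_, hgN ⟨u, hu⟩⟩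
  have halt : τ.IsAlt := fun s => by
    rw [hτ s s _ (hr s), hr s]
    exact self_eq_neg.1 (hskew _ _)
  refine ⟨S, τ, gS, halt, nondegenerate_of_isAlt halt fun s hs => ?_, fun _ => rfl,
    fun s s' => ?_, hS, ?_⟩
  · refine Subtype.ext (hc ?_)
    rw [hr s, Submodule.coe_zero, map_zero]
    funext i
    obtain ⟨u, hu⟩ := hrange (Pi.single i 1)
    have h := hs ⟨u, (hS u).2 ⟨_, hu⟩⟩
    rw [hτ s _ _ (hr s)] at h
    change r s ⬝ᵥ c u = 0 at h
    rw [hu, hskew, neg_eq_zero] at h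
    simpa using h
  · rw [hτ (gS s) s' _ (hgN s), hτ s (gS s') _ (hr s), hτ s s' _ (hr s)]
    have h1 : c (gS s') = f *ᵥ c s' := hg s'
    rw [h1, sub_dotProduct, smul_dotProduct, smul_eq_mul, Matrix.mulVec_transpose,
      ← Matrix.dotProduct_mulVec]
    ring
  · have h1 : S.map c = LinearMap.range N.mulVecLin := by
      refine Submodule.map_comap_eq_of_le ?_
      rintro _ ⟨y, rfl⟩
      obtain ⟨u, hu⟩ := hrange y
      exact ⟨u, hu⟩
    rw [Matrix.rank, ← h1]
    exact (LinearEquiv.finrank_eq (Submodule.equivMapOfInjective c hc S))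

end Bivector

/-! ### From cocalibrated structures to the normal forms -/

section LieAlgebra

variable {𝔤 : Type*} [LieRing 𝔤] [LieAlgebra ℂ 𝔤] [FiniteDimensional ℂ 𝔤]

theorem trace_toEnd_eq_trace_ad (𝔲 : LieIdeal ℂ 𝔤) (e₇ : 𝔤)
    (h : ∀ x, LieAlgebra.ad ℂ 𝔤 e₇ x ∈ 𝔲) :
    LinearMap.trace ℂ 𝔲 (LieModule.toEnd ℂ 𝔤 𝔲 e₇) =
      LinearMap.trace ℂ 𝔤 (LieAlgebra.ad ℂ 𝔤 e₇) := by
  have h1 := LinearMap.trace_comp_comm' 𝔲.toSubmodule.subtype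
    ((LieAlgebra.ad ℂ 𝔤 e₇).codRestrict 𝔲.toSubmodule h)
  exact h1

/-- The alternatives are `n·n ≠ 0` and `n·n = 0`. The second records that `𝔲` is degenerate, so that
part (a) can discard it. -/
theorem similar_of_cocalibrated (h𝔤 : finrank ℂ 𝔤 = 7) (𝔲 : LieIdeal ℂ 𝔤)
    (h𝔲 : finrank ℂ 𝔲 = 6) (habel : IsLieAbelian 𝔲) (e₇ : 𝔤) (he₇ : e₇ ∉ 𝔲)
    {ω₆ : LinearMap.BilinForm ℂ 𝔲} (hω₆ : ω₆.IsAlt) (hn₆ : ω₆.Nondegenerate)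
    {V₂ V₄ : Submodule ℂ 𝔲} (hV₄ : finrank ℂ V₄ = 4)
    (hV : IsCompl V₂ V₄) {ω₄ : LinearMap.BilinForm ℂ V₄} (hω₄ : ω₄.IsAlt)
    (hn₄ : ω₄.Nondegenerate) {φ : Form 𝔤 3} {vol : Form 𝔤 7}
    (h : IsCocalibratedG2Structure φ vol) :
    IsSimilarToElementOf (LieModule.toEnd ℂ 𝔤 𝔲 e₇) (skewAdjointLieSubalgebra ω₆) ∨
      (IsSimilarToElementOf (LieModule.toEnd ℂ 𝔤 𝔲 e₇) (lengthTwoStabilizer V₂ V₄ ω₄) ∧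
        ¬ IsNondegenerateSubspace φ vol 𝔲.toSubmodule) := by
  obtain ⟨α, he, hmem, hbr⟩ := exists_conormal h𝔤 𝔲 h𝔲 habel e₇ he₇
  obtain ⟨E, rfl, rfl, hd⟩ := (isCocalibratedG2Structure_iff _ _).1 h
  set F := LieAlgebra.ad ℂ 𝔤 e₇ with hF
  have hFu : ∀ x, F x ∈ 𝔲 := by
    intro x
    have hx : x - α x • e₇ ∈ 𝔲 := (hmem _).2 (by simp [he])
    have h1 : F x = F (x - α x • e₇) := by simp [hF]
    rw [h1]
    exact lie_mem_right _ _ _ _ _ hx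
  have hα : ∀ x, α (F x) = 0 := fun x => (hmem _).1 (hFu x)
  set n : Fin 7 → ℂ := fun i => α (E i) with hn
  set f : Matrix (Fin 7) (Fin 7) ℂ := Matrix.of fun i j => E.coord i (F (E j)) with hf
  have hfE : f = LinearMap.toMatrix E E F := by
    ext i j
    simp [hf, LinearMap.toMatrix_apply]
  have htr : LinearMap.trace ℂ 𝔲 (LieModule.toEnd ℂ 𝔤 𝔲 e₇) = f.trace := by
    rw [trace_toEnd_eq_trace_ad 𝔲 e₇ hFu, hfE, ← LinearMap.trace_eq_matrix_trace ℂ E]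
  have hαn : ∀ x, α x = n ⬝ᵥ E.equivFun x := by
    intro x
    conv_lhs => rw [← E.sum_equivFun x, map_sum]
    exact Finset.sum_congr rfl fun i _ => by rw [map_smul, smul_eq_mul, mul_comm]
  have hn0 : n ≠ 0 := by
    intro h0
    have := hαn e₇
    rw [h0, zero_dotProduct, he] at this
    exact one_ne_zero this
  have hrel := crossMatrix_relation hbr hα hd hn hf
  let c : 𝔲 →ₗ[ℂ] (Fin 7 → ℂ) := E.equivFun.toLinearMap ∘ₗ 𝔲.toSubmodule.subtype
  have hc : Function.Injective c := E.equivFun.injective.comp Subtype.val_injective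
  have hcn : ∀ u, n ⬝ᵥ c u = 0 := fun u => (hαn u).symm.trans ((hmem _).1 u.2)
  have hcr : ∀ v, n ⬝ᵥ v = 0 → ∃ u, c u = v := by
    intro v hv
    refine ⟨⟨E.equivFun.symm v, (hmem _).2 ?_⟩, ?_⟩
    · rw [hαn, LinearEquiv.apply_symm_apply, hv]
    · exact E.equivFun.apply_symm_apply v
  have hg : ∀ u, c (LieModule.toEnd ℂ 𝔤 𝔲 e₇ u) = f *ᵥ c u := by
    intro u
    rw [hfE]
    exact (LinearMap.toMatrix_mulVec_repr E E F (u : 𝔤)).symm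
  obtain ⟨S, τ, gS, halt, hnd, hgS, hconf, hS, hrk⟩ := exists_conformal_form hc hg
    (crossMatrix_transpose n) hrel fun y => hcr _ (dotProduct_crossMatrix_mulVec n y)
  rw [← htr] at hconf
  by_cases hnn : n ⬝ᵥ n = 0
  · refine Or.inr ⟨isSimilarToElementOf_lengthTwoStabilizer hV₄ hV hω₄ hn₄
      (hrk.trans (le_antisymm (rank_crossMatrix_le_four hnn) (four_le_rank_crossMatrix hn0 hnn)))
      halt hnd hgS hconf, ?_⟩
    rintro ⟨B, hB, hBn⟩
    obtain rfl := hB.eq_orthoForm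
    -- A null `n` is orthogonal to itself, so it is the coordinate vector of some `u` in `𝔲`, and
    -- that `u` is orthogonal to all of `𝔲`.
    obtain ⟨u, hu⟩ := hcr n hnn
    have hu0 : u = 0 := hBn.1 u fun v => by
      change orthoForm E u v = 0
      have h1 : orthoForm E u v = c u ⬝ᵥ c v := orthoForm_apply E _ _
      rw [h1, hu, hcn]
    rw [hu0, map_zero] at hu
    exact hn0 hu.symm
  · left
    have hST : ∀ u, u ∈ S := by
      intro u
      -- On `n⊥` the matrix squares to `-(n·n)`, which supplies the preimage.
      refine (hS u).2 ⟨crossMatrix n *ᵥ (-(n ⬝ᵥ n)⁻¹ • c u), ?_⟩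
      rw [crossMatrix_mulVec_mulVec, dotProduct_smul, hcn, smul_zero, zero_smul, add_zero,
        smul_smul, neg_mul_neg, mul_inv_cancel₀ hnn, one_smul]
    let ι : 𝔲 ≃ₗ[ℂ] S :=
      (LinearEquiv.ofTop S (eq_top_iff.2 fun u _ => hST u)).symm
    refine isSimilarToElementOf_skewAdjoint h𝔲 (ω := τ.compl₁₂ ι.toLinearMap ι.toLinearMap)
      (fun x => halt _) (nondegenerate_of_isAlt (fun x => halt _) fun x hx => ?_) hω₆ hn₆
      fun x y => ?_
    · refine ι.map_eq_zero_iff.1 (hnd.1 _ fun y => ?_)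
      have := hx (ι.symm y)
      simpa using this
    · have hι : ∀ x, ι (LieModule.toEnd ℂ 𝔤 𝔲 e₇ x) = gS (ι x) := fun x =>
        Subtype.ext (hgS (ι x))
      simp only [LinearMap.compl₁₂_apply, LinearEquiv.coe_coe, hι]
      exact hconf _ _

end LieAlgebra

end G2C

end

theorem mainTheorem6 {𝔤 : Type*} [LieRing 𝔤] [LieAlgebra ℂ 𝔤] [FiniteDimensional ℂ 𝔤]
    (h𝔤 : Module.finrank ℂ 𝔤 = 7)
    (𝔲 : LieIdeal ℂ 𝔤) (h𝔲 : Module.finrank ℂ 𝔲 = 6) (habel : IsLieAbelian 𝔲)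
    (e₇ : 𝔤) (he₇ : e₇ ∉ 𝔲)
    (ω₆ : LinearMap.BilinForm ℂ 𝔲) (hω₆ : ω₆.IsAlt) (hω₆' : ω₆.Nondegenerate)
    (V₂ V₄ : Submodule ℂ 𝔲) (hV₂ : Module.finrank ℂ V₂ = 2) (hV₄ : Module.finrank ℂ V₄ = 4)
    (hV : IsCompl V₂ V₄)
    (ω₄ : LinearMap.BilinForm ℂ V₄) (hω₄ : ω₄.IsAlt) (hω₄' : ω₄.Nondegenerate) :
    ((∃ (φ : G2C.Form 𝔤 3) (vol : G2C.Form 𝔤 7),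
        G2C.IsCocalibratedG2Structure φ vol ∧
        G2C.IsNondegenerateSubspace φ vol 𝔲.toSubmodule) ↔
      G2C.IsSimilarToElementOf (LieModule.toEnd ℂ 𝔤 𝔲 e₇) (skewAdjointLieSubalgebra ω₆)) ∧
    ((∃ (φ : G2C.Form 𝔤 3) (vol : G2C.Form 𝔤 7), G2C.IsCocalibratedG2Structure φ vol) ↔
      (G2C.IsSimilarToElementOf (LieModule.toEnd ℂ 𝔤 𝔲 e₇) (skewAdjointLieSubalgebra ω₆) ∨
        G2C.IsSimilarToElementOf (LieModule.toEnd ℂ 𝔤 𝔲 e₇)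
          (G2C.lengthTwoStabilizer V₂ V₄ ω₄))) := by
  refine ⟨⟨?_, ?_⟩, ?_, ?_⟩
  · rintro ⟨φ, vol, hc, hn⟩
    exact (G2C.similar_of_cocalibrated h𝔤 𝔲 h𝔲 habel e₇ he₇ hω₆ hω₆' hV₄ hV hω₄
      hω₄' hc).resolve_right fun h => h.2 hn
  · exact G2C.exists_cocalibrated_of_skewAdjoint h𝔤 𝔲 h𝔲 habel e₇ he₇ hω₆ hω₆'
  · rintro ⟨φ, vol, hc⟩
    exact (G2C.similar_of_cocalibrated h𝔤 𝔲 h𝔲 habel e₇ he₇ hω₆ hω₆' hV₄ hV hω₄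
      hω₄' hc).imp_right And.left
  · rintro (h | h)
    · obtain ⟨φ, vol, hc, -⟩ := G2C.exists_cocalibrated_of_skewAdjoint h𝔤 𝔲 h𝔲 habel e₇ he₇
        hω₆ hω₆' h
      exact ⟨φ, vol, hc⟩
    · exact G2C.exists_cocalibrated_of_lengthTwoStabilizer h𝔤 𝔲 h𝔲 habel e₇ he₇ hV₂ hV₄ hV hω₄
        hω₄' h
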